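/- Let $\mathcal A$ be a (not necessarily unital) $C^*$-algebra and let $E$ be a Hilbert $C^*$-module over $\mathcal A$, with inner product $\langle\cdot,\cdot\rangle$ conjugate linear in the first and linear in the second variable. For a densely defined operator $T$ in $E$ the adjoint $T^*$ is defined by: $y\in\operatorname{dom}(T^*)$ and $T^*y=z$ if and only if $\langle Tx,y\rangle=\langle x,z\rangle$ for all $x\in\operatorname{dom}(T)$. An operator $T$ is called semiregular if $\operatorname{dom}(T)$ is a dense $\mathcal A$-submodule of $E$ and $T^*$ is densely defined; it is called selfadjoint if it is semiregular and $T=T^*$, and regular if it is closed, semiregular, and $I+T^*T$ has dense range. Let $S$ and $T$ be selfadjoint and regular operators in $E$, and suppose that there is a dense $\mathcal A$-submodule $\mathcal E\subset E$ such that: 1. $\mathcal E\subset\operatorname{dom}(T)$ is a core for $T$; 2. $(S-i\mu)^{-1}\xi\in\operatorname{dom}(S)\cap\operatorname{dom}(T)$ and $T(S-i\mu)^{-1}\xi\in\operatorname{dom}(S)$ for all $\mu\in\mathbb R\setminus\{0\}$ and all $\xi\in\mathcal E$; 3. for every $\mu\in\mathbb R\setminus\{0\}$ the homomorphism $[S,T](S-i\mu)^{-1}:\mathcal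 E\to E$ extends to a bounded $\mathcal A$-linear operator $X_\mu:E\to E$, where $[S,T]=ST-TS$. Then the operator $$D=\begin{pmatrix}0&S-iT\\ S+iT&0\end{pmatrix},\qquad \operatorname{dom}(D)=\bigl(\operatorname{dom}(S)\cap\operatorname{dom}(T)\bigr)^2\subset E\oplus E,$$ is selfadjoint and regular. -/

import Mathlib

open scoped WithCStarModule

noncomputable section

namespace HilbertModule

/-!
Unbounded operators on a Hilbert `C⋆`-module `E` over a (not necessarily unital) `C⋆`-algebra `A`.
The inner product is conjugate linear in the first and linear in the second variable; the action of
`A` on `E` is the one of Mathlib's `CStarModule`, `⟪x, a • y⟫ = a * ⟪x, y⟫` (a right module over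
an algebra `B` in the usual notation is a `CStarModule` over `A = Bᵐᵒᵖ`).
-/

section Algebra

variable {E F G : Type*} [AddCommGroup E] [Module ℂ E] [AddCommGroup F] [Module ℂ F]
  [AddCommGroup G] [Module ℂ G]

/-- The composition `g ∘ f` of partially defined operators on its natural domain
`{x ∈ dom f | f x ∈ dom g}`. -/
def pcomp (g : F →ₗ.[ℂ] G) (f : E →ₗ.[ℂ] F) : E →ₗ.[ℂ] G where
  domain := (g.domain.comap f.toFun).map f.domain.subtype
  toFun :=
    { toFun := fun x => g ⟨f ⟨x, by
          obtain ⟨y, -, hy⟩ := x.2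
          exact hy ▸ y.2⟩, by
          obtain ⟨_, y, hy, rfl⟩ := x
          exact hy⟩
      map_add' := fun x y => by
        rw [← g.map_add]
        congr 1
        exact Subtype.ext (f.map_add ⟨x, _⟩ ⟨y, _⟩)
      map_smul' := fun c x => by
        rw [RingHom.id_apply, ← g.map_smul]
        congr 1
        exact Subtype.ext (f.map_smul c ⟨x, _⟩) }

theorem mem_pcomp_domain (g : F →ₗ.[ℂ] G) (f : E →ₗ.[ℂ] F) (x : E) :
    x ∈ (pcomp g f).domain ↔ ∃ hx : x ∈ f.domain, f ⟨x, hx⟩ ∈ g.domain := by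
  constructor
  · rintro ⟨y, hy, rfl⟩
    exact ⟨y.2, hy⟩
  · rintro ⟨hx, h⟩
    exact ⟨⟨x, hx⟩, h, rfl⟩

theorem pcomp_apply (g : F →ₗ.[ℂ] G) (f : E →ₗ.[ℂ] F) (x : E) (hx : x ∈ f.domain)
    (h : f ⟨x, hx⟩ ∈ g.domain) :
    pcomp g f ⟨x, (mem_pcomp_domain g f x).2 ⟨hx, h⟩⟩ = g ⟨f ⟨x, hx⟩, h⟩ := rfl

/-- The commutator `[S, T] = S T - T S` on its natural domain `dom (S T) ∩ dom (T S)`. -/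
def commutator (S T : E →ₗ.[ℂ] E) : E →ₗ.[ℂ] E := pcomp S T - pcomp T S

/-- The resolvent `(S - i μ)⁻¹`, with domain the range of `S - i μ` and range `dom S`. -/
def resolvent (S : E →ₗ.[ℂ] E) (μ : ℝ) : E →ₗ.[ℂ] E :=
  LinearPMap.inverse ((-(Complex.I * (μ : ℂ))) • (LinearMap.id : E →ₗ[ℂ] E) +ᵥ S)

end Algebra

section Operators

variable (A : Type*) {E : Type*} [NonUnitalCStarAlgebra A] [PartialOrder A]
  [NormedAddCommGroup E] [NormedSpace ℂ E] [SMul A E]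

/-- A complex subspace is an `A`-submodule if it is stable under the action of `A`. -/
def IsSubmodule (M : Submodule ℂ E) : Prop := ∀ a : A, ∀ x ∈ M, a • x ∈ M

variable [StarOrderedRing A] [CStarModule A E]

/-- The graph of the adjoint of `T`: all `(y, z)` with `⟪T x, y⟫ = ⟪x, z⟫` for all `x ∈ dom T`. -/
def adjointGraph (T : E →ₗ.[ℂ] E) : Submodule ℂ (E × E) where
  carrier := {p | ∀ x : T.domain, inner A (T x) p.1 = inner A (x : E) p.2}
  zero_mem' := fun x => by simp
  add_mem' := fun {p q} hp hq x => by simp [hp x, hq x]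
  smul_mem' := fun c p hp x => by simp [hp x]

/-- The adjoint `T*` of a densely defined operator `T`. -/
def adjoint (T : E →ₗ.[ℂ] E) : E →ₗ.[ℂ] E := (adjointGraph A T).toLinearPMap

/-- For densely defined `T`: `y ∈ dom T*` and `T* y = z` if and only if
`⟪T x, y⟫ = ⟪x, z⟫` for all `x ∈ dom T`. -/
theorem adjoint_graph (T : E →ₗ.[ℂ] E) (hT : Dense (T.domain : Set E)) :
    (adjoint A T).graph = adjointGraph A T := by
  refine Submodule.toLinearPMap_graph_eq _ ?_
  rintro ⟨y, z⟩ h (rfl : y = 0)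
  have h1 : ∀ x : E, inner A x z = 0 := by
    have hc : Continuous fun x : E => inner A x z :=
      CStarModule.continuous_inner.comp (continuous_id.prodMk continuous_const)
    have hcl : IsClosed {x : E | inner A x z = 0} := isClosed_singleton.preimage hc
    intro x
    refine hcl.closure_subset_iff.2 (fun w hw => ?_) (hT x)
    have := h ⟨w, hw⟩
    simpa using this.symm
  exact CStarModule.inner_self.1 (h1 z)

/-- `T` is semiregular: its domain is a dense `A`-submodule and its adjoint is densely defined. -/
structure IsSemiregular (T : E →ₗ.[ℂ] E) : Prop where
  isSubmodule_domain : IsSubmodule A T.domain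
  dense_domain : Dense (T.domain : Set E)
  dense_adjoint_domain : Dense ((adjoint A T).domain : Set E)

/-- `T` is regular: it is closed and semiregular, and `1 + T* T` has dense range. -/
structure IsRegular (T : E →ₗ.[ℂ] E) : Prop where
  isSemiregular : IsSemiregular A T
  isClosed : T.IsClosed
  dense_range : Dense (Set.range ((LinearMap.id : E →ₗ[ℂ] E) +ᵥ pcomp (adjoint A T) T))

/-- `T` is selfadjoint: it is semiregular and `T = T*`, domains included. -/
structure IsSelfadjoint (T : E →ₗ.[ℂ] E) : Prop where
  isSemiregular : IsSemiregular A T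
  eq_adjoint : T = adjoint A T

/-- The smallness condition on the commutator of `S` and `T`, for a dense submodule `M`. -/
structure CommutatorCondition (S T : E →ₗ.[ℂ] E) (M : Submodule ℂ E) : Prop where
  isSubmodule : IsSubmodule A M
  dense : Dense (M : Set E)
  /-- `M ⊆ dom T` is a core for `T`. -/
  core : T.HasCore M
  /-- For `ξ ∈ M`: `(S - i μ)⁻¹ ξ` is defined and lies in `dom S ∩ dom T`. -/
  resolvent_mem : ∀ μ : ℝ, μ ≠ 0 → ∀ ξ ∈ M, ∃ hξ : ξ ∈ (resolvent S μ).domain,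
    resolvent S μ ⟨ξ, hξ⟩ ∈ S.domain ⊓ T.domain
  /-- For `ξ ∈ M`: `T (S - i μ)⁻¹ ξ` lies in `dom S`. -/
  apply_resolvent_mem : ∀ μ : ℝ, μ ≠ 0 → ∀ ξ ∈ M, ∃ hξ : ξ ∈ (pcomp T (resolvent S μ)).domain,
    pcomp T (resolvent S μ) ⟨ξ, hξ⟩ ∈ S.domain
  /-- `[S, T] (S - i μ)⁻¹` on `M` extends to a bounded `A`-linear operator on `E`. -/
  bounded : ∀ μ : ℝ, μ ≠ 0 → ∃ X : E →L[ℂ] E, (∀ (a : A) (x : E), X (a • x) = a • X x) ∧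
    ∀ ξ ∈ M, ∃ hξ : ξ ∈ (pcomp (commutator S T) (resolvent S μ)).domain,
      X ξ = pcomp (commutator S T) (resolvent S μ) ⟨ξ, hξ⟩

end Operators

section Matrix

variable (A : Type*) {E : Type*} [AddCommGroup E] [Module ℂ E]

/-- The operator matrix `[[0, P], [Q, 0]]` on the Hilbert module `E ⊕ E`, with domain
`dom Q ⊕ dom P`. -/
def offDiagonal (P Q : E →ₗ.[ℂ] E) : C⋆ᵐᵒᵈ(A, E × E) →ₗ.[ℂ] C⋆ᵐᵒᵈ(A, E × E) where
  domain := (Q.domain.prod P.domain).comap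
    (WithCStarModule.linearEquiv ℂ A (E × E) : C⋆ᵐᵒᵈ(A, E × E) →ₗ[ℂ] E × E)
  toFun :=
    { toFun := fun x => (WithCStarModule.equiv A (E × E)).symm
        (P ⟨(x : C⋆ᵐᵒᵈ(A, E × E)).2, x.2.2⟩, Q ⟨(x : C⋆ᵐᵒᵈ(A, E × E)).1, x.2.1⟩)
      map_add' := fun x y => congrArg (WithCStarModule.equiv A (E × E)).symm
        (Prod.ext (P.map_add ⟨_, x.2.2⟩ ⟨_, y.2.2⟩) (Q.map_add ⟨_, x.2.1⟩ ⟨_, y.2.1⟩))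
      map_smul' := fun c x => congrArg (WithCStarModule.equiv A (E × E)).symm
        (Prod.ext (P.map_smul c ⟨_, x.2.2⟩) (Q.map_smul c ⟨_, x.2.1⟩)) }

/-- The sum operator `D = [[0, S - i T], [S + i T, 0]]` with domain `(dom S ∩ dom T)²`. -/
def sumOperator (S T : E →ₗ.[ℂ] E) : C⋆ᵐᵒᵈ(A, E × E) →ₗ.[ℂ] C⋆ᵐᵒᵈ(A, E × E) :=
  offDiagonal A (S - Complex.I • T) (S + Complex.I • T)

theorem mem_sumOperator_domain (S T : E →ₗ.[ℂ] E) (x : C⋆ᵐᵒᵈ(A, E × E)) :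
    x ∈ (sumOperator A S T).domain ↔
      x.1 ∈ S.domain ⊓ T.domain ∧ x.2 ∈ S.domain ⊓ T.domain := Iff.rfl

theorem sumOperator_apply (S T : E →ₗ.[ℂ] E) (x y : E) (hx : x ∈ S.domain ⊓ T.domain)
    (hy : y ∈ S.domain ⊓ T.domain) :
    sumOperator A S T ⟨(WithCStarModule.equiv A (E × E)).symm (x, y), hx, hy⟩ =
      (WithCStarModule.equiv A (E × E)).symm
        (S ⟨y, hy.1⟩ - Complex.I • T ⟨y, hy.2⟩, S ⟨x, hx.1⟩ + Complex.I • T ⟨x, hx.2⟩) := rfl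

end Matrix

end HilbertModule

end

/-!
With `R = (S - i)⁻¹` the commutator condition for `μ = 1` says that `T R = R T + R X` on a core of
`T`, hence, `T` being closed, on all of `dom T`; only this identity is used. In other words
`[S, T] = X (S - i)` with `X` bounded, so that `⟪S x, T x⟫ - ⟪T x, S x⟫` is bounded by a multiple of
`‖x‖ (‖S x‖ + ‖x‖)`. Consequently `‖S x‖` and `‖T x‖` are controlled by `‖(S ± i T) x‖ + ‖x‖`, and
`D` is closed (`IsWeaklyCommutingPair.exists_limit`).

A closed symmetric operator `D` is selfadjoint and regular as soon as `D - i` and `D + i` have dense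
range (`isSelfadjoint_and_isRegular_of_dense_range`). Since weak compactness is not available in
Hilbert modules, dense range is obtained from approximate solutions with a rate. Let
`K = (1 ± i T / n)⁻¹`. By a Neumann series `K` preserves `dom S` and `[S, K]` is `n⁻¹` times an
operator that is bounded relative to `S`, uniformly in `n` (`IsSmoothing.exists_commutator`). Let
`M = (1 + T² / n²)⁻¹` and `H = T M`, a bounded symmetric operator for which `[S, H]` is bounded
relative to `S`, uniformly in `n`.

With `H` in place of `T` the equation `(D - i ν) (u, v) = (f, g)`, `ν = ±1`, is solvable by the
method of continuity (`exists_offDiagonal_solution`), and its solutions satisfy a priori bounds for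
`u`, `v`, `S u`, `S v` that do not depend on `n`. If `f`, `g` lie in `dom T`, then `T K`, which
commutes with `H`, maps the solution to the solution of an equation whose data are again bounded
independently of `n`. The a priori bounds now also cover `T K u` and `T K S u`, so that
`(1 - K) u = ± i n⁻¹ T K u` and `(1 - K) S u` are of order `n⁻¹`
(`IsSmoothing.norm_sub_le_of_solution`). As `T M = H`, the vector `(M u, M v)` solves the original
equation up to an error of order `n⁻¹` (`IsWeaklyCommutingPair.exists_approximate_solution`).
-/

namespace HilbertModule

/-! ### Linear relations bounded below -/

section Relations

variable {F : Type*} [NormedAddCommGroup F] [NormedSpace ℂ F]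

/-- A relation `G` for which `B = y + P x`, `(x, y) ∈ G`, is onto and bounded below by `c` has a
bounded inverse. Graphs are used rather than partially defined maps, to avoid dependent types. -/
theorem exists_inverse_of_bounded_below {G : Submodule ℂ (F × F)} {P : F →L[ℂ] F} {c : ℝ}
    (hc : 0 < c) (hb : ∀ p ∈ G, c * ‖p.1‖ ≤ ‖p.2 + P p.1‖)
    (hs : ∀ f, ∃ p ∈ G, p.2 + P p.1 = f) :
    ∃ R : F →L[ℂ] F, (∀ f, ‖R f‖ ≤ c⁻¹ * ‖f‖) ∧ (∀ f, (R f, f - P (R f)) ∈ G) ∧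
      ∀ p ∈ G, R (p.2 + P p.1) = p.1 := by
  choose g hgG hg using hs
  have huniq : ∀ p ∈ G, ∀ q ∈ G, p.2 + P p.1 = q.2 + P q.1 → p.1 = q.1 := by
    intro p hp q hq h
    have h1 := hb _ (G.sub_mem hp hq)
    have h2 : (p - q).2 + P (p - q).1 = 0 := by
      rw [Prod.snd_sub, Prod.fst_sub, map_sub, ← sub_eq_zero.2 h]; abel
    rw [h2, norm_zero] at h1
    have h3 : ‖(p - q).1‖ ≤ 0 := by
      by_contra! h4
      exact absurd h1 (not_le.2 (mul_pos hc h4))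
    exact sub_eq_zero.1 (norm_le_zero_iff.1 h3)
  let R₀ : F →ₗ[ℂ] F :=
    { toFun := fun f => (g f).1
      map_add' := fun f f' => by
        refine huniq _ (hgG _) _ (G.add_mem (hgG f) (hgG f')) ?_
        rw [hg, Prod.snd_add, Prod.fst_add, map_add, add_add_add_comm, hg, hg]
      map_smul' := fun a f => by
        refine huniq _ (hgG _) _ (G.smul_mem a (hgG f)) ?_
        simp only [hg, Prod.smul_snd, Prod.smul_fst, map_smul, ← smul_add] }
  have hR : ∀ f, ‖R₀ f‖ ≤ c⁻¹ * ‖f‖ := fun f => by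
    have := hb _ (hgG f)
    rw [hg] at this
    rw [inv_mul_eq_div, le_div_iff₀ hc, mul_comm]
    exact this
  refine ⟨R₀.mkContinuous c⁻¹ hR, hR, fun f => ?_, fun p hp => ?_⟩
  · have h : f - P (g f).1 = (g f).2 := sub_eq_iff_eq_add.2 (hg f).symm
    change ((g f).1, f - P (g f).1) ∈ G
    rw [h]
    exact hgG f
  · exact huniq _ (hgG _) _ hp (hg _)

variable [CompleteSpace F]

/-- Neumann series: surjectivity is stable under perturbations smaller than the lower bound. -/
theorem surjective_add_of_norm_lt {G : Submodule ℂ (F × F)} {P Q : F →L[ℂ] F} {c : ℝ}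
    (hb : ∀ p ∈ G, c * ‖p.1‖ ≤ ‖p.2 + P p.1‖) (hs : ∀ f, ∃ p ∈ G, p.2 + P p.1 = f)
    (hQ : ‖Q‖ < c) (f : F) : ∃ p ∈ G, p.2 + (P + Q) p.1 = f := by
  have hc : 0 < c := (norm_nonneg Q).trans_lt hQ
  obtain ⟨R, hR, hRG, -⟩ := exists_inverse_of_bounded_below hc hb hs
  have hR' : ‖R‖ ≤ c⁻¹ := R.opNorm_le_bound (inv_nonneg.2 hc.le) hR
  have hlt : ‖-(Q * R)‖ < 1 := by
    rw [norm_neg]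
    calc ‖Q * R‖ ≤ ‖Q‖ * ‖R‖ := norm_mul_le _ _
      _ ≤ ‖Q‖ * c⁻¹ := by gcongr
      _ < c * c⁻¹ := by gcongr
      _ = 1 := mul_inv_cancel₀ hc.ne'
  have hu : IsUnit (1 + Q * R) := by
    have := isUnit_one_sub_of_norm_lt_one hlt
    rwa [sub_neg_eq_add] at this
  obtain ⟨V, hV⟩ := hu.exists_right_inv
  have hw : V f + Q (R (V f)) = f := by
    simpa using congrArg (fun B : F →L[ℂ] F => B f) hV
  refine ⟨_, hRG (V f), ?_⟩
  change V f - P (R (V f)) + (P (R (V f)) + Q (R (V f))) = f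
  rw [← add_assoc, sub_add_cancel, hw]

/-- The method of continuity along `P + t Q`, `t ∈ [0, 1]`. -/
theorem surjective_add_of_path {G : Submodule ℂ (F × F)} {P Q : F →L[ℂ] F} {c : ℝ} (hc : 0 < c)
    (hb : ∀ t : ℝ, 0 ≤ t → t ≤ 1 → ∀ p ∈ G, c * ‖p.1‖ ≤ ‖p.2 + (P + (t : ℂ) • Q) p.1‖)
    (hs : ∀ f, ∃ p ∈ G, p.2 + P p.1 = f) (f : F) : ∃ p ∈ G, p.2 + (P + Q) p.1 = f := by
  obtain ⟨N, hN⟩ := exists_nat_gt (‖Q‖ / c)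
  have hN0 : (0 : ℝ) < N := (div_nonneg (norm_nonneg _) hc.le).trans_lt hN
  have key : ∀ k : ℕ, k ≤ N →
      ∀ f, ∃ p ∈ G, p.2 + (P + (((k / N : ℝ)) : ℂ) • Q) p.1 = f := by
    intro k
    induction k with
    | zero => intro _ f; simpa using hs f
    | succ k ih =>
      intro hk f
      have hkN : (k : ℝ) ≤ N := by exact_mod_cast (Nat.le_succ k).trans hk
      have := surjective_add_of_norm_lt (Q := ((N : ℂ)⁻¹) • Q)
        (hb (k / N) (by positivity) ((div_le_one hN0).2 hkN)) (ih ((Nat.le_succ k).trans hk))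
        (by
          rw [norm_smul, norm_inv, Complex.norm_natCast, inv_mul_eq_div, div_lt_iff₀ hN0, mul_comm]
          exact (div_lt_iff₀ hc).1 hN) f
      have he : P + (((k / N : ℝ)) : ℂ) • Q + ((N : ℂ)⁻¹) • Q
          = P + ((((k + 1 : ℕ) : ℝ) / N : ℝ) : ℂ) • Q := by
        rw [add_assoc, ← add_smul]
        congr 2
        push_cast
        ring
      rwa [he] at this
  have := key N le_rfl f
  simpa [div_self hN0.ne'] using this

/-- For a closed relation bounded below, dense range implies surjectivity. -/
theorem surjective_of_dense_range {G : Submodule ℂ (F × F)} (hG : IsClosed (G : Set (F × F)))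
    {P : F →L[ℂ] F} {c : ℝ} (hc : 0 < c) (hb : ∀ p ∈ G, c * ‖p.1‖ ≤ ‖p.2 + P p.1‖)
    (hd : Dense {f | ∃ p ∈ G, p.2 + P p.1 = f}) (f : F) : ∃ p ∈ G, p.2 + P p.1 = f := by
  obtain ⟨u, hu, hlim⟩ := mem_closure_iff_seq_limit.1 (hd f)
  choose p hpG hp using hu
  have hcau : CauchySeq fun n => (p n).1 := by
    rw [Metric.cauchySeq_iff]
    intro ε hε
    obtain ⟨N, hN⟩ := Metric.cauchySeq_iff.1 hlim.cauchySeq (c * ε) (mul_pos hc hε)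
    refine ⟨N, fun m hm n hn => ?_⟩
    have h1 := hN m hm n hn
    have h2 := hb _ (G.sub_mem (hpG m) (hpG n))
    have h3 : (p m - p n).2 + P (p m - p n).1 = u m - u n := by
      rw [Prod.snd_sub, Prod.fst_sub, map_sub, ← hp m, ← hp n]; abel
    rw [h3, ← dist_eq_norm, Prod.fst_sub, ← dist_eq_norm] at h2
    exact lt_of_mul_lt_mul_left (h2.trans_lt h1) hc.le
  obtain ⟨x, hx⟩ := cauchySeq_tendsto_of_complete hcau
  refine ⟨(x, f - P x), ?_, sub_add_cancel _ _⟩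
  refine hG.mem_of_tendsto (f := fun n => ((p n).1, u n - P (p n).1)) (b := Filter.atTop)
    (hx.prodMk_nhds (hlim.sub ((P.continuous.tendsto x).comp hx))) (Filter.Eventually.of_forall ?_)
  intro n
  have : u n - P (p n).1 = (p n).2 := by rw [← hp n, add_sub_cancel_right]
  rw [this]
  exact hpG n

end Relations

/-! ### Symmetric operators -/

section Symmetric

variable {A F : Type*} [NonUnitalCStarAlgebra A] [PartialOrder A] [StarOrderedRing A]
  [NormedAddCommGroup F] [NormedSpace ℂ F] [SMul A F] [CStarModule A F]

theorem norm_le_of_inner_self_le {x y : F} (h : inner A x x ≤ inner A y y) : ‖x‖ ≤ ‖y‖ := by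
  rw [CStarModule.norm_eq_sqrt_norm_inner_self (A := A) x,
    CStarModule.norm_eq_sqrt_norm_inner_self (A := A) y]
  exact Real.sqrt_le_sqrt
    (CStarAlgebra.norm_le_norm_of_nonneg_of_le CStarModule.inner_self_nonneg h)

/-- For symmetric `S` and real `μ`: `|μ| ‖x‖ ≤ ‖(S - i μ) x‖`, where `y = S x`. -/
theorem norm_le_norm_sub_I_smul {x y : F} (h : inner A y x = inner A x y) (μ : ℝ) :
    |μ| * ‖x‖ ≤ ‖y - (Complex.I * μ) • x‖ := by
  have h1 : inner A (y - (Complex.I * μ) • x) (y - (Complex.I * μ) • x)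
      = inner A y y + inner A ((μ : ℂ) • x) ((μ : ℂ) • x) := by
    simp only [CStarModule.inner_sub_left, CStarModule.inner_sub_right,
      CStarModule.inner_smul_left_complex, CStarModule.inner_smul_right_complex, h, smul_sub,
      smul_smul]
    simp only [star_mul', RCLike.star_def, Complex.conj_I, Complex.conj_ofReal]
    have e1 : Complex.I * (μ : ℂ) * (-Complex.I * μ) = μ * μ := by
      linear_combination (-(μ : ℂ) * μ) * Complex.I_mul_I
    rw [e1, neg_mul, neg_smul]
    abel
  have h2 : ‖(μ : ℂ) • x‖ ≤ ‖y - (Complex.I * μ) • x‖ := by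
    refine norm_le_of_inner_self_le (A := A) ?_
    rw [h1]
    exact le_add_of_nonneg_left CStarModule.inner_self_nonneg
  rwa [norm_smul, Complex.norm_real, Real.norm_eq_abs] at h2

end Symmetric

/-! ### Selfadjoint regular operators and their resolvents -/

section SelfadjointRegular

variable {A F : Type*} [NonUnitalCStarAlgebra A] [PartialOrder A]
  [NormedAddCommGroup F] [NormedSpace ℂ F] [SMul A F] [CStarModule A F]

/-- For `ε = ±1` the range of `S - i ε` contains that of `(S - i ε) (S + i ε) = 1 + S* S`. -/
theorem dense_range_sub_I_smul {S : F →ₗ.[ℂ] F} (hS : IsSelfadjoint A S) (hS' : IsRegular A S)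
    {ε : ℝ} (hε : ε * ε = 1) :
    Dense {f | ∃ p ∈ S.graph, p.2 + (-(Complex.I * (ε : ℂ)) • (1 : F →L[ℂ] F)) p.1 = f} := by
  refine hS'.dense_range.mono ?_
  rintro _ ⟨⟨x, hx⟩, rfl⟩
  obtain ⟨hxS, hSx⟩ := (mem_pcomp_domain _ _ _).1 hx
  have h1 : ((x, S ⟨x, hxS⟩) : F × F) ∈ S.graph := S.mem_graph ⟨x, hxS⟩
  have h2 : ((S ⟨x, hxS⟩, adjoint A S ⟨S ⟨x, hxS⟩, hSx⟩) : F × F) ∈ S.graph := by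
    have hg : S.graph = (adjoint A S).graph := congrArg _ hS.eq_adjoint
    exact hg ▸ (adjoint A S).mem_graph ⟨S ⟨x, hxS⟩, hSx⟩
  refine ⟨_, S.graph.add_mem h2 (S.graph.smul_mem (Complex.I * (ε : ℂ)) h1), ?_⟩
  rw [LinearPMap.vadd_apply, pcomp_apply _ _ _ hxS hSx]
  have e1 : Complex.I * (ε : ℂ) * (Complex.I * ε) = -1 := by
    have : (ε : ℂ) * ε = 1 := by exact_mod_cast hε
    linear_combination (ε * ε : ℂ) * Complex.I_mul_I - this
  change adjoint A S ⟨S ⟨x, hxS⟩, hSx⟩ + (Complex.I * (ε : ℂ)) • S ⟨x, hxS⟩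
    + (-(Complex.I * (ε : ℂ))) • (S ⟨x, hxS⟩ + (Complex.I * (ε : ℂ)) • x)
    = x + adjoint A S ⟨S ⟨x, hxS⟩, hSx⟩
  linear_combination (norm := module) -(e1 • x)

variable [StarOrderedRing A]

theorem IsSelfadjoint.inner_eq {S : F →ₗ.[ℂ] F} (hS : IsSelfadjoint A S) :
    ∀ p ∈ S.graph, ∀ q ∈ S.graph, inner A p.2 q.1 = inner A p.1 q.2 := by
  intro p hp q hq
  have hq' : q ∈ (adjoint A S).graph := hS.eq_adjoint ▸ hq
  rw [adjoint_graph A S hS.isSemiregular.dense_domain] at hq'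
  obtain ⟨x, hx1, hx2⟩ := (LinearPMap.mem_graph_iff S).1 hp
  rw [← hx1, ← hx2]
  exact hq' x

variable [CompleteSpace F]

/-- `S - i μ` is onto for every real `μ ≠ 0`: regularity gives `μ = ±1`, and `|μ|` is moved away
from `1` by the method of continuity. -/
theorem surjective_sub_I_smul {S : F →ₗ.[ℂ] F} (hS : IsSelfadjoint A S) (hS' : IsRegular A S)
    {μ : ℝ} (hμ : μ ≠ 0) (f : F) : ∃ p ∈ S.graph, p.2 - (Complex.I * μ) • p.1 = f := by
  obtain ⟨ε, hε, hεμ⟩ : ∃ ε : ℝ, ε * ε = 1 ∧ ε * μ = |μ| := by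
    rcases hμ.lt_or_gt with h | h
    · exact ⟨-1, by norm_num, by rw [abs_of_neg h]; ring⟩
    · exact ⟨1, by norm_num, by rw [abs_of_pos h]; ring⟩
  have hε1 : |ε| = 1 := by
    have := abs_mul_abs_self ε
    rw [hε] at this
    nlinarith [abs_nonneg ε]
  have hc : 0 < min 1 |μ| := lt_min one_pos (abs_pos.2 hμ)
  have hsym := hS.inner_eq
  have hval : ∀ (s : ℝ) (x y : F), y + (-(Complex.I * (s : ℂ)) • (1 : F →L[ℂ] F)) x
      = y - (Complex.I * s) • x := fun s x y => by
    simp [sub_eq_add_neg]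
  have hbase := surjective_of_dense_range hS'.isClosed one_pos
    (P := -(Complex.I * (ε : ℂ)) • (1 : F →L[ℂ] F)) (fun p hp => by
      rw [hval, ← hε1]
      exact norm_le_norm_sub_I_smul (hsym p hp p hp) ε) (dense_range_sub_I_smul hS hS' hε)
  have hpath := surjective_add_of_path (G := S.graph) hc
    (P := -(Complex.I * (ε : ℂ)) • (1 : F →L[ℂ] F))
    (Q := -(Complex.I * ((μ - ε : ℝ) : ℂ)) • (1 : F →L[ℂ] F)) (fun t ht0 ht1 p hp => by
      have e : -(Complex.I * (ε : ℂ)) • (1 : F →L[ℂ] F)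
          + (t : ℂ) • -(Complex.I * ((μ - ε : ℝ) : ℂ)) • (1 : F →L[ℂ] F)
          = -(Complex.I * ((ε + t * (μ - ε) : ℝ) : ℂ)) • (1 : F →L[ℂ] F) := by
        rw [smul_smul, ← add_smul]
        congr 1
        push_cast
        ring
      rw [e, hval]
      refine le_trans ?_ (norm_le_norm_sub_I_smul (hsym p hp p hp) _)
      gcongr
      calc min 1 |μ| = (1 - t) * min 1 |μ| + t * min 1 |μ| := by ring
        _ ≤ (1 - t) * 1 + t * |μ| := by
          exact add_le_add (mul_le_mul_of_nonneg_left (min_le_left _ _) (by linarith))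
            (mul_le_mul_of_nonneg_left (min_le_right _ _) ht0)
        _ = ε * (ε + t * (μ - ε)) := by rw [← hεμ]; linear_combination (t - 1) * hε
        _ ≤ |ε * (ε + t * (μ - ε))| := le_abs_self _
        _ = |ε + t * (μ - ε)| := by rw [abs_mul, hε1, one_mul]) hbase f
  obtain ⟨p, hp, h⟩ := hpath
  refine ⟨p, hp, ?_⟩
  rw [← add_smul, ← neg_add, ← mul_add, ← Complex.ofReal_add, add_sub_cancel, hval] at h
  exact h

/-- The resolvent `R = (S - i μ)⁻¹` of a selfadjoint regular operator. -/
theorem exists_resolvent {S : F →ₗ.[ℂ] F} (hS : IsSelfadjoint A S) (hS' : IsRegular A S)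
    {μ : ℝ} (hμ : μ ≠ 0) : ∃ R : F →L[ℂ] F, (∀ f, ‖R f‖ ≤ |μ|⁻¹ * ‖f‖) ∧
      (∀ f, (R f, f + (Complex.I * μ) • R f) ∈ S.graph) ∧
      ∀ p ∈ S.graph, R (p.2 - (Complex.I * μ) • p.1) = p.1 := by
  have hval : ∀ (x y : F), y + (-(Complex.I * (μ : ℂ)) • (1 : F →L[ℂ] F)) x
      = y - (Complex.I * μ) • x := fun x y => by
    simp [sub_eq_add_neg]
  obtain ⟨R, h1, h2, h3⟩ := exists_inverse_of_bounded_below (G := S.graph)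
    (P := -(Complex.I * (μ : ℂ)) • (1 : F →L[ℂ] F)) (abs_pos.2 hμ)
    (fun p hp => by
      rw [hval]
      exact norm_le_norm_sub_I_smul (hS.inner_eq p hp p hp) μ)
    (fun f => by
      obtain ⟨p, hp, h⟩ := surjective_sub_I_smul hS hS' hμ f
      exact ⟨p, hp, by rw [hval, h]⟩)
  refine ⟨R, h1, fun f => ?_, fun p hp => ?_⟩
  · have := h2 f
    simpa using this
  · have := h3 p hp
    rwa [hval] at this

/-- A closed symmetric operator for which `D - i` and `D + i` have dense range is selfadjoint and
regular. -/
theorem isSelfadjoint_and_isRegular_of_dense_range {D : F →ₗ.[ℂ] F}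
    (hsub : IsSubmodule A D.domain) (hdom : Dense (D.domain : Set F))
    (hsym : ∀ p ∈ D.graph, ∀ q ∈ D.graph, inner A p.2 q.1 = inner A p.1 q.2)
    (hcl : D.IsClosed)
    (hd : ∀ ν : ℝ, |ν| = 1 → Dense {f | ∃ p ∈ D.graph, p.2 - (Complex.I * ν) • p.1 = f}) :
    IsSelfadjoint A D ∧ IsRegular A D := by
  have hval : ∀ (s : ℝ) (x y : F), y + (-(Complex.I * (s : ℂ)) • (1 : F →L[ℂ] F)) x
      = y - (Complex.I * s) • x := fun s x y => by
    simp [sub_eq_add_neg]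
  have hsurj : ∀ ν : ℝ, |ν| = 1 → ∀ f, ∃ p ∈ D.graph, p.2 - (Complex.I * ν) • p.1 = f := by
    intro ν hν f
    have := surjective_of_dense_range (G := D.graph) hcl one_pos
      (P := -(Complex.I * (ν : ℂ)) • (1 : F →L[ℂ] F)) (fun p hp => by
        rw [hval, ← hν]
        exact norm_le_norm_sub_I_smul (hsym p hp p hp) ν) (by simpa only [hval] using hd ν hν) f
    simpa only [hval] using this
  -- For `y ∈ dom D*` pick `p.1 ∈ dom D` with `(D - i) p.1 = (D* - i) y`. Then `y - p.1` is
  -- orthogonal to the range of `D + i`, hence zero.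
  have hadj : D = adjoint A D := by
    refine LinearPMap.eq_of_eq_graph ?_
    rw [adjoint_graph A D hdom]
    refine le_antisymm (fun q hq x => hsym _ (D.mem_graph x) q hq) ?_
    rintro ⟨y, z⟩ h
    obtain ⟨p, hp, hpz⟩ := hsurj 1 (by simp) (z - (Complex.I * (1 : ℝ)) • y)
    obtain ⟨q, hq, hqy⟩ := hsurj (-1) (by simp) (y - p.1)
    have h0 : inner A q.2 y = inner A q.1 z := by
      obtain ⟨x, hx1, hx2⟩ := (LinearPMap.mem_graph_iff D).1 hq
      rw [← hx1, ← hx2]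
      exact h x
    have h1 : inner A (y - p.1) (y - p.1) = 0 := by
      have e1 : inner A (y - p.1) y = inner A q.1 (z - (Complex.I * (1 : ℝ)) • y) := by
        rw [← hqy]
        simp [h0, sub_eq_add_neg]
      have e2 : inner A (y - p.1) p.1 = inner A q.1 (p.2 - (Complex.I * (1 : ℝ)) • p.1) := by
        rw [← hqy]
        simp [hsym q hq p hp, sub_eq_add_neg]
      rw [CStarModule.inner_sub_right, e1, e2, hpz, sub_self]
    have h2 : y = p.1 := sub_eq_zero.1 (CStarModule.inner_self.1 h1)
    have h3 : p.2 = z := by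
      rw [← h2] at hpz
      exact sub_left_injective hpz
    rw [h2, ← h3]
    exact hp
  have hsemi : IsSemiregular A D := ⟨hsub, hdom, by rw [← hadj]; exact hdom⟩
  refine ⟨⟨hsemi, hadj⟩, ⟨hsemi, hcl, ?_⟩⟩
  -- `1 + D² = (D + i) (D - i)` is onto.
  refine dense_univ.mono fun f _ => ?_
  obtain ⟨p, hp, hpf⟩ := hsurj (-1) (by simp) f
  obtain ⟨q, hq, hqp⟩ := hsurj 1 (by simp) p.1
  have hq2 : (q.2, p.2 + Complex.I • q.2) ∈ D.graph := by
    have := D.graph.add_mem hp (D.graph.smul_mem Complex.I hq)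
    convert! this using 2
    simp [← hqp]
  rw [← hadj]
  obtain ⟨x, hx1, hx2⟩ := (LinearPMap.mem_graph_iff D).1 hq
  obtain ⟨y, hy1, hy2⟩ := (LinearPMap.mem_graph_iff D).1 hq2
  dsimp only at hy1 hy2
  have hxD : D x ∈ D.domain := by
    rw [hx2]
    exact LinearPMap.mem_domain_of_mem_graph hq2
  have hDx : D ⟨D x, hxD⟩ = p.2 + Complex.I • q.2 := by
    rw [← hy2]
    congr 1
    exact Subtype.ext (hx2.trans hy1.symm)
  refine ⟨⟨x, (mem_pcomp_domain _ _ _).2 ⟨x.2, hxD⟩⟩, ?_⟩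
  rw [LinearPMap.vadd_apply, pcomp_apply _ _ _ x.2 hxD]
  change (x : F) + D ⟨D x, hxD⟩ = f
  rw [hDx, hx1, ← hpf, ← hqp]
  push_cast
  linear_combination (norm := module) Complex.I_mul_I • q.1

end SelfadjointRegular

/-! ### Smoothing operators and commutators -/

section Smoothing

variable {E : Type*} [NormedAddCommGroup E] [NormedSpace ℂ E]

/-- `K = (1 + i m⁻¹ T)⁻¹`, a contraction, where `G` is the graph of `T`. The second field encodes
`T K = -i m (1 - K)`. -/
structure IsSmoothing (G : Submodule ℂ (E × E)) (m : ℝ) (K : E →L[ℂ] E) : Prop where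
  norm_apply_le : ∀ x, ‖K x‖ ≤ ‖x‖
  mem : ∀ x, (K x, -(Complex.I * m) • (x - K x)) ∈ G
  apply_add : ∀ p ∈ G, K (p.1 + (Complex.I / m) • p.2) = p.1

namespace IsSmoothing

variable {G : Submodule ℂ (E × E)} {m m' : ℝ} {K K' : E →L[ℂ] E}

theorem I_mul_mul_I_div (hm : m ≠ 0) : (Complex.I * m) * (Complex.I / m) = -1 := by
  have : (m : ℂ) ≠ 0 := by exact_mod_cast hm
  field_simp
  exact Complex.I_sq

/-- `T K = K T` on the domain of `T`. -/
theorem apply_snd (hK : IsSmoothing G m K) (hm : m ≠ 0) {p : E × E} (hp : p ∈ G) :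
    K p.2 = -(Complex.I * m) • (p.1 - K p.1) := by
  have h := hK.apply_add p hp
  have e := I_mul_mul_I_div hm
  rw [map_add, map_smul] at h
  linear_combination (norm := module) (-(Complex.I * m)) • h + e • K p.2

theorem map_mem (hK : IsSmoothing G m K) (hm : m ≠ 0) {p : E × E} (hp : p ∈ G) :
    (K p.1, K p.2) ∈ G := by
  rw [hK.apply_snd hm hp]
  exact hK.mem p.1

theorem apply_comm (hK : IsSmoothing G m K) (hm : m ≠ 0) (hK' : IsSmoothing G m' K')
    (hm' : m' ≠ 0) (x : E) : K (K' x) = K' (K x) := by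
  have h := hK'.apply_add _ (hK.map_mem hm (hK'.mem x))
  have e := I_mul_mul_I_div hm'
  dsimp only at h
  rw [← h]
  congr 1
  simp only [map_smul, map_sub]
  linear_combination (norm := module) -(e • (K x - K (K' x)))

/-- With `p = (x', T x')` and `x'` close to `x`, this gives `K x → x` as `|m| → ∞`. -/
theorem norm_sub_le (hK : IsSmoothing G m K) (hm : m ≠ 0) {p : E × E} (hp : p ∈ G) (x : E) :
    ‖x - K x‖ ≤ 2 * ‖x - p.1‖ + ‖p.2‖ / |m| := by
  have h : p.1 - K p.1 = (Complex.I / m) • K p.2 := by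
    have e := I_mul_mul_I_div hm
    rw [hK.apply_snd hm hp]
    linear_combination (norm := module) e • (p.1 - K p.1)
  have h2 : ‖p.1 - K p.1‖ ≤ ‖p.2‖ / |m| := by
    rw [h, norm_smul, norm_div, Complex.norm_I, Complex.norm_real, Real.norm_eq_abs,
      one_div_mul_eq_div]
    gcongr
    exact hK.norm_apply_le _
  calc ‖x - K x‖ = ‖(x - p.1) - K (x - p.1) + (p.1 - K p.1)‖ := by
        rw [map_sub]; congr 1; abel
    _ ≤ ‖x - p.1‖ + ‖K (x - p.1)‖ + ‖p.1 - K p.1‖ :=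
        (norm_add_le _ _).trans (by gcongr; exact _root_.norm_sub_le _ _)
    _ ≤ ‖x - p.1‖ + ‖x - p.1‖ + ‖p.2‖ / |m| := by
        gcongr
        exact hK.norm_apply_le _
    _ = 2 * ‖x - p.1‖ + ‖p.2‖ / |m| := by ring

/-- The adjoint of `(1 + i m⁻¹ T)⁻¹` is `(1 - i m⁻¹ T)⁻¹`. -/
theorem inner_apply_left {A : Type*} [NonUnitalCStarAlgebra A] [PartialOrder A]
    [SMul A E] [CStarModule A E]
    (hsym : ∀ p ∈ G, ∀ q ∈ G, inner A p.2 q.1 = inner A p.1 q.2) (hm : m ≠ 0)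
    (hK : IsSmoothing G m K) (hK' : IsSmoothing G (-m) K') (x y : E) :
    inner A (K x) y = inner A x (K' y) := by
  have h := hsym _ (hK.mem x) _ (hK'.mem y)
  simp only [CStarModule.inner_smul_left_complex, CStarModule.inner_smul_right_complex,
    CStarModule.inner_sub_left, CStarModule.inner_sub_right] at h
  have e1 : star (-(Complex.I * (m : ℂ))) = Complex.I * m := by simp
  have e2 : -(Complex.I * ((-m : ℝ) : ℂ)) = Complex.I * m := by simp
  rw [e1, e2] at h
  have h0 : Complex.I * (m : ℂ) ≠ 0 := mul_ne_zero Complex.I_ne_zero (by exact_mod_cast hm)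
  exact (sub_left_injective (smul_right_injective A h0 h)).symm

variable [CompleteSpace E]

/-- If `[S, T] = X (S - i)`, as encoded by `T R = R T + R X` for `R = (S - i)⁻¹`, then the
smoothing operators `K` of large parameter `m` preserve the domain of `S`, and
`[S, K] = -i m⁻¹ C (S - i)` with `C` bounded uniformly in `m`. -/
theorem exists_commutator (hK : IsSmoothing G m K) (hm : m ≠ 0) {GS : Submodule ℂ (E × E)}
    {R X : E →L[ℂ] E} (hR : ∀ s, (R s, s + Complex.I • R s) ∈ GS)
    (hR' : ∀ p ∈ GS, R (p.2 - Complex.I • p.1) = p.1)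
    (hX : ∀ p ∈ G, (R p.1, R p.2 + R (X p.1)) ∈ G) (hXm : 2 * ‖X‖ ≤ |m|) :
    ∃ C : E →L[ℂ] E, (∀ x, ‖C x‖ ≤ 2 * ‖X‖ * ‖x‖) ∧
      ∀ p ∈ GS, (K p.1, K p.2 - (Complex.I / m) • C (p.2 - Complex.I • p.1)) ∈ GS := by
  have hm' : 0 < |m| := abs_pos.2 hm
  have e := I_mul_mul_I_div hm
  -- `K R = R Y` for `Y = (1 + N)⁻¹ K`, `N = i m⁻¹ K X`; hence `Y - K = -i m⁻¹ C`, `C = K X Y`.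
  set N : E →L[ℂ] E := (Complex.I / m) • K.comp X with hN
  have hNx : ∀ x, ‖N x‖ ≤ 1 / 2 * ‖x‖ := fun x => by
    calc ‖N x‖ = ‖K (X x)‖ / |m| := by
          change ‖(Complex.I / (m : ℂ)) • K (X x)‖ = _
          rw [norm_smul, norm_div, Complex.norm_I, Complex.norm_real, Real.norm_eq_abs,
            one_div_mul_eq_div]
      _ ≤ ‖X‖ * ‖x‖ / |m| := by
          gcongr
          exact (hK.norm_apply_le _).trans (X.le_opNorm x)
      _ ≤ 1 / 2 * ‖x‖ := by
          rw [div_le_iff₀ hm']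
          nlinarith [norm_nonneg x]
  have hlt : ‖-N‖ < 1 := by
    rw [norm_neg]
    exact (N.opNorm_le_bound (by norm_num) hNx).trans_lt (by norm_num)
  have hu : IsUnit (1 + N) := by
    have := isUnit_one_sub_of_norm_lt_one hlt
    rwa [sub_neg_eq_add] at this
  obtain ⟨V, hV⟩ := hu.exists_right_inv
  have hV' : ∀ f, V f + N (V f) = f := fun f => by
    simpa using congrArg (fun B : E →L[ℂ] E => B f) hV
  have hVle : ∀ f, ‖V f‖ ≤ 2 * ‖f‖ := fun f => by
    have h1 : V f = f - N (V f) := eq_sub_of_add_eq (hV' f)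
    have h2 : ‖V f‖ ≤ ‖f‖ + ‖N (V f)‖ := by
      conv_lhs => rw [h1]
      exact _root_.norm_sub_le _ _
    linarith [hNx (V f)]
  refine ⟨K.comp (X.comp (V.comp K)), fun x => ?_, fun p hp => ?_⟩
  · calc ‖K (X (V (K x)))‖ ≤ ‖X (V (K x))‖ := hK.norm_apply_le _
      _ ≤ ‖X‖ * ‖V (K x)‖ := X.le_opNorm _
      _ ≤ ‖X‖ * (2 * ‖x‖) := by
          gcongr
          exact (hVle _).trans (by gcongr; exact hK.norm_apply_le _)
      _ = 2 * ‖X‖ * ‖x‖ := by ring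
  · set s := p.2 - Complex.I • p.1 with hs
    have hY : V (K s) = K s - (Complex.I / m) • K (X (V (K s))) := eq_sub_of_add_eq (hV' (K s))
    set w := s - (Complex.I / m) • X (V (K s)) with hw
    have hKw : K w = V (K s) := by rw [hw, map_sub, map_smul, ← hY]
    have hKR : K (R s) = R (V (K s)) := by
      have h := hK.apply_add _ (hX _ (hK.mem w))
      simp only at h
      rw [← hKw, ← h]
      congr 1
      have h3 : s = K w + (Complex.I / m) • (-(Complex.I * m) • (w - K w) + X (K w)) := by
        rw [hKw, hw]
        linear_combination (norm := module) e • (s - (Complex.I / m) • X (V (K s)) - V (K s))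
      conv_lhs => rw [h3]
      simp only [map_add, map_smul]
    have h4 : K p.1 = R (V (K s)) := by rw [← hKR, hR' p hp]
    have h5 := hR (V (K s))
    rw [← h4] at h5
    convert! h5 using 2
    change K p.2 - (Complex.I / m) • K (X (V (K s))) = _
    have h6 : K p.2 = K s + Complex.I • K p.1 := by
      rw [hs, map_sub, map_smul, sub_add_cancel]
    rw [h6]
    linear_combination (norm := module) -hY

end IsSmoothing

end Smoothing

/-! ### The commutator condition in terms of resolvents -/

section Resolvent

variable {A E : Type*} [NonUnitalCStarAlgebra A] [PartialOrder A] [StarOrderedRing A]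
  [NormedAddCommGroup E] [NormedSpace ℂ E] [SMul A E] [CStarModule A E]

/-- `(S - i μ) (S - i μ)⁻¹ ξ = ξ` for the partially defined resolvent. -/
theorem resolvent_apply_eq {S : E →ₗ.[ℂ] E} (hS : IsSelfadjoint A S) {μ : ℝ} (hμ : μ ≠ 0)
    (ξ : (resolvent S μ).domain) :
    (resolvent S μ ξ, (ξ : E) + (Complex.I * μ) • resolvent S μ ξ) ∈ S.graph := by
  set f := (-(Complex.I * (μ : ℂ))) • (LinearMap.id : E →ₗ[ℂ] E) +ᵥ S with hf
  have hker : LinearMap.ker f.toFun = ⊥ := by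
    refine LinearMap.ker_eq_bot'.2 fun x hx => ?_
    have hx' : S x - (Complex.I * μ) • (x : E) = 0 := by
      rw [← hx]
      change _ = -(Complex.I * (μ : ℂ)) • (x : E) + S x
      module
    have h := norm_le_norm_sub_I_smul (hS.inner_eq _ (S.mem_graph x) _ (S.mem_graph x)) μ
    rw [hx', norm_zero] at h
    have h0 : ‖(x : E)‖ ≤ 0 := by
      by_contra! h4
      exact absurd h (not_le.2 (mul_pos (abs_pos.2 hμ) h4))
    exact Subtype.ext (norm_le_zero_iff.1 h0)
  have h1 := (resolvent S μ).mem_graph ξ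
  change _ ∈ f.inverse.graph at h1
  rw [LinearPMap.inverse_graph hker] at h1
  obtain ⟨p, hp, hpξ⟩ := h1
  obtain ⟨x, hx1, hx2⟩ := (LinearPMap.mem_graph_iff _).1 hp
  have e1 : p.2 = ξ := congrArg Prod.fst hpξ
  have e2 : p.1 = resolvent S μ ξ := congrArg Prod.snd hpξ
  rw [← e1, ← e2, ← hx1, ← hx2]
  have hxS : (x : E) ∈ S.domain := x.2
  have h2 : f x = -(Complex.I * (μ : ℂ)) • (x : E) + S ⟨x, hxS⟩ := rfl
  convert! S.mem_graph ⟨x, hxS⟩ using 2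
  rw [h2]
  module

/-- The commutator condition at `μ = 1`, extended from the core to all of `dom T`:
`T R = R T + R X` with `R = (S - i)⁻¹`. -/
theorem CommutatorCondition.exists_resolvent_comm {S T : E →ₗ.[ℂ] E} {M : Submodule ℂ E}
    (h : CommutatorCondition A S T M) (hS : IsSelfadjoint A S) (hT : T.IsClosed)
    {R : E →L[ℂ] E} (hR : ∀ p ∈ S.graph, R (p.2 - Complex.I • p.1) = p.1) :
    ∃ X : E →L[ℂ] E, ∀ p ∈ T.graph, (R p.1, R p.2 + R (X p.1)) ∈ T.graph := by
  obtain ⟨X, -, hX⟩ := h.bounded 1 one_ne_zero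
  refine ⟨X, ?_⟩
  have hM : ∀ p ∈ (T.domRestrict M).graph, (R p.1, R p.2 + R (X p.1)) ∈ T.graph := by
    intro p hp
    have hpT : p ∈ T.graph := LinearPMap.le_graph_of_le LinearPMap.domRestrict_le hp
    have hpM : p.1 ∈ M := (LinearPMap.mem_domain_of_mem_graph (y := p.2) hp).1
    obtain ⟨hξ, hXξ⟩ := hX p.1 hpM
    obtain ⟨hξ1, hξ2⟩ := (mem_pcomp_domain _ _ _).1 hξ
    rw [pcomp_apply _ _ _ hξ1 hξ2] at hXξ
    have hr := resolvent_apply_eq hS one_ne_zero ⟨p.1, hξ1⟩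
    set r := resolvent S 1 ⟨p.1, hξ1⟩ with hrdef
    obtain ⟨hrT, hTr⟩ := (mem_pcomp_domain _ _ _).1 hξ2.1
    obtain ⟨hrS, hSr⟩ := (mem_pcomp_domain _ _ _).1 hξ2.2
    have hX2 : X p.1 = S ⟨T ⟨r, hrT⟩, hTr⟩ - T ⟨S ⟨r, hrS⟩, hSr⟩ := hXξ
    have g1 := T.mem_graph ⟨r, hrT⟩
    have g2 := S.mem_graph ⟨T ⟨r, hrT⟩, hTr⟩
    have g3 := T.mem_graph ⟨S ⟨r, hrS⟩, hSr⟩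
    have hSr' : S ⟨r, hrS⟩ = p.1 + Complex.I • r := by
      have := S.mem_graph_snd_inj (S.mem_graph ⟨r, hrS⟩) hr rfl
      simpa using this
    have hRr : R p.1 = r := by
      have := hR _ (S.mem_graph ⟨r, hrS⟩)
      rwa [hSr', add_sub_cancel_right] at this
    have hTp : p.2 = T ⟨S ⟨r, hrS⟩, hSr⟩ - Complex.I • T ⟨r, hrT⟩ := by
      refine T.mem_graph_snd_inj hpT (T.graph.sub_mem g3 (T.graph.smul_mem Complex.I g1)) ?_
      simp [hSr']
    have hfin : R p.2 + R (X p.1) = T ⟨r, hrT⟩ := by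
      have := hR _ g2
      dsimp only at this
      rw [← this, ← map_add, hTp, hX2]
      congr 1
      abel
    rw [hRr, hfin]
    exact g1
  have hcl : IsClosed {p : E × E | (R p.1, R p.2 + R (X p.1)) ∈ (T.graph : Set (E × E))} :=
    IsClosed.preimage (by fun_prop) hT
  intro p hp
  have hclos : (T.domRestrict M).IsClosable :=
    hT.isClosable.leIsClosable LinearPMap.domRestrict_le
  have hg := hclos.graph_closure_eq_closure_graph
  rw [h.core.closure_eq] at hg
  rw [← hg] at hp
  exact closure_minimal (s := ((T.domRestrict M).graph : Set (E × E))) hM hcl hp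

variable [CompleteSpace E]

theorem exists_isSmoothing {T : E →ₗ.[ℂ] E} (hT : IsSelfadjoint A T) (hT' : IsRegular A T)
    {m : ℝ} (hm : m ≠ 0) : ∃ K : E →L[ℂ] E, IsSmoothing T.graph m K := by
  obtain ⟨R, hR1, hR2, hR3⟩ := exists_resolvent hT hT' hm
  have e := IsSmoothing.I_mul_mul_I_div hm
  refine ⟨(-(Complex.I * m)) • R, fun x => ?_, fun x => ?_, fun p hp => ?_⟩
  · change ‖(-(Complex.I * (m : ℂ))) • R x‖ ≤ ‖x‖
    rw [norm_smul, norm_neg, norm_mul, Complex.norm_I, Complex.norm_real, one_mul,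
      Real.norm_eq_abs, ← le_inv_mul_iff₀ (abs_pos.2 hm)]
    exact hR1 x
  · have := T.graph.smul_mem (-(Complex.I * (m : ℂ))) (hR2 x)
    rw [Prod.smul_mk] at this
    change (-(Complex.I * (m : ℂ)) • R x,
      -(Complex.I * (m : ℂ)) • (x - -(Complex.I * (m : ℂ)) • R x)) ∈ T.graph
    rwa [neg_smul _ (R x), sub_neg_eq_add, ← neg_smul]
  · change (-(Complex.I * (m : ℂ))) • R (p.1 + (Complex.I / (m : ℂ)) • p.2) = p.1
    have h := hR3 p hp
    rw [map_sub, map_smul] at h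
    rw [map_add, map_smul]
    linear_combination (norm := module) h - e • R p.2

end Resolvent

/-! ### A priori estimates and solvability for bounded `H` in place of `T` -/

section Energy

variable {A E : Type*} [NonUnitalCStarAlgebra A] [PartialOrder A]
  [NormedAddCommGroup E] [NormedSpace ℂ E] [SMul A E] [CStarModule A E]

/-- Symmetry of `[[0, S - i H], [S + i H, 0]]` on the diagonal, with `p = (u, S u)` and
`q = (v, S v)`. -/
theorem inner_pair_eq {GS : Submodule ℂ (E × E)} {H : E → E}
    (hS : ∀ p ∈ GS, ∀ q ∈ GS, inner A p.2 q.1 = inner A p.1 q.2)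
    (hH : ∀ x y, inner A (H x) y = inner A x (H y)) {p q : E × E} (hp : p ∈ GS) (hq : q ∈ GS) :
    inner A (q.2 - Complex.I • H q.1) p.1 + inner A (p.2 + Complex.I • H p.1) q.1
      = inner A p.1 (q.2 - Complex.I • H q.1) + inner A q.1 (p.2 + Complex.I • H p.1) := by
  simp only [CStarModule.inner_add_left, CStarModule.inner_add_right, CStarModule.inner_sub_left,
    CStarModule.inner_sub_right, CStarModule.inner_smul_left_complex,
    CStarModule.inner_smul_right_complex, hS p hp q hq, hS q hq p hp, hH, RCLike.star_def,
    Complex.conj_I]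
  module

variable [StarOrderedRing A]

/-- A Gårding-type estimate: with `s = S x` and `t = T x`, smallness of `⟪s, t⟫ - ⟪t, s⟫` lets
`S ± i T` control `S`. -/
theorem norm_le_of_commutator_le {σ : ℂ} (hσ : star σ = -σ) (hσ2 : σ * σ = -1) {k : ℝ}
    (hk : 0 ≤ k) {x s t : E}
    (h : ‖inner A s t - inner A t s‖ ≤ k * ‖x‖ * (‖s‖ + ‖x‖)) :
    ‖s‖ ≤ 2 * (‖s + σ • t‖ + (k + 1) * ‖x‖) := by
  have hσn : ‖σ‖ = 1 := by
    have := congrArg norm hσ2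
    rw [norm_mul, norm_neg, norm_one] at this
    nlinarith [norm_nonneg σ]
  have h1 : inner A (s + σ • t) (s + σ • t)
      = inner A s s + inner A t t + σ • (inner A s t - inner A t s) := by
    simp only [CStarModule.inner_add_left, CStarModule.inner_add_right,
      CStarModule.inner_smul_left_complex, CStarModule.inner_smul_right_complex, hσ]
    linear_combination (norm := module) -(hσ2 • inner A t t)
  have h2 : ‖s‖ ^ 2 ≤ ‖s + σ • t‖ ^ 2 + k * ‖x‖ * (‖s‖ + ‖x‖) := by
    rw [CStarModule.norm_sq_eq A (x := s), CStarModule.norm_sq_eq A (x := s + σ • t)]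
    calc ‖inner A s s‖ ≤ ‖inner A s s + inner A t t‖ :=
          CStarAlgebra.norm_le_norm_of_nonneg_of_le CStarModule.inner_self_nonneg
            (le_add_of_nonneg_right CStarModule.inner_self_nonneg)
      _ = ‖inner A (s + σ • t) (s + σ • t) - σ • (inner A s t - inner A t s)‖ := by
          rw [h1, add_sub_cancel_right]
      _ ≤ ‖inner A (s + σ • t) (s + σ • t)‖ + ‖σ • (inner A s t - inner A t s)‖ :=
          norm_sub_le _ _
      _ ≤ _ := by
          rw [norm_smul, hσn, one_mul]
          gcongr
  by_contra! hlt
  have hx := norm_nonneg x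
  have hb := norm_nonneg (s + σ • t)
  have hs := norm_nonneg s
  have h3 : k * ‖x‖ * ‖s‖ ≤ ‖s‖ / 2 * ‖s‖ := by
    gcongr
    nlinarith
  have h4 : (‖s + σ • t‖ + (k + 1) * ‖x‖) ^ 2 ≤ (‖s‖ / 2) ^ 2 := by
    gcongr
    linarith
  have h5 : ‖s + σ • t‖ ^ 2 + k * ‖x‖ * ‖x‖ ≤ (‖s + σ • t‖ + (k + 1) * ‖x‖) ^ 2 := by
    nlinarith [mul_nonneg hb hx, mul_nonneg (mul_nonneg hb hk) hx, mul_nonneg hk hk,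
      mul_nonneg (mul_nonneg hk hk) (mul_nonneg hx hx), mul_nonneg hk (mul_nonneg hx hx),
      mul_nonneg hx hx]
  have h6 : 0 < ‖s‖ := lt_of_le_of_lt (by positivity) hlt
  nlinarith

/-- For symmetric `D` on `E ⊕ E` with `D (u, v) = (r, s)`, the components of `(u, v)` are bounded
by those of `(D - i ν) (u, v)`. The inequality of the Hilbert module norms on `E ⊕ E` is what is
proved; it is recorded here in terms of the norm of `E`. -/
theorem norm_pair_le_norm_sub_I_smul {u v s r : E}
    (h : inner A r u + inner A s v = inner A u r + inner A v s) {ν : ℝ} (hν : |ν| = 1) :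
    ‖u‖ ≤ ‖r - (Complex.I * ν) • u‖ + ‖s - (Complex.I * ν) • v‖ ∧
      ‖v‖ ≤ ‖r - (Complex.I * ν) • u‖ + ‖s - (Complex.I * ν) • v‖ := by
  have h1 := norm_le_norm_sub_I_smul (A := A) (F := C⋆ᵐᵒᵈ(A, E × E))
    (x := (WithCStarModule.equiv A (E × E)).symm (u, v))
    (y := (WithCStarModule.equiv A (E × E)).symm (r, s)) h ν
  rw [hν, one_mul] at h1
  have h2 := h1.trans (WithCStarModule.prod_norm_le_norm_add _)
  have h3 := WithCStarModule.max_le_prod_norm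
    ((WithCStarModule.equiv A (E × E)).symm (u, v))
  exact ⟨(le_max_left _ _).trans (h3.trans h2), (le_max_right _ _).trans (h3.trans h2)⟩

/-- `⟪S u, H u⟫ - ⟪H u, S u⟫ = ⟪u, [S, H] u⟫`, where `u = p.1` and
`[S, H] u` is the vector `w` of `hC`. -/
theorem norm_inner_sub_inner_le {GS : Submodule ℂ (E × E)} {H : E → E}
    (hS : ∀ p ∈ GS, ∀ q ∈ GS, inner A p.2 q.1 = inner A p.1 q.2)
    (hH : ∀ x y, inner A (H x) y = inner A x (H y)) {k : ℝ}
    (hC : ∀ p ∈ GS, ∃ w, (H p.1, H p.2 + w) ∈ GS ∧ ‖w‖ ≤ k * (‖p.2‖ + ‖p.1‖))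
    {p : E × E} (hp : p ∈ GS) :
    ‖inner A p.2 (H p.1) - inner A (H p.1) p.2‖ ≤ k * ‖p.1‖ * (‖p.2‖ + ‖p.1‖) := by
  obtain ⟨w, hw, hwn⟩ := hC p hp
  have e : inner A p.2 (H p.1) - inner A (H p.1) p.2 = inner A p.1 w := by
    rw [hS _ hp _ hw, hH]
    simp
  rw [e]
  calc _ ≤ ‖p.1‖ * ‖w‖ := CStarModule.norm_inner_le E
    _ ≤ ‖p.1‖ * (k * (‖p.2‖ + ‖p.1‖)) := by gcongr
    _ = _ := by ring

/-- A priori bounds for `D - i ν`, with `D = [[0, S - i H], [S + i H, 0]]` and bounded `H`; the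
constant only depends on the bound `k` for `[S, H]` relative to `S`. -/
theorem norm_le_of_commutator_bound {GS : Submodule ℂ (E × E)} {H : E → E}
    (hS : ∀ p ∈ GS, ∀ q ∈ GS, inner A p.2 q.1 = inner A p.1 q.2)
    (hH : ∀ x y, inner A (H x) y = inner A x (H y)) {k : ℝ} (hk : 0 ≤ k)
    (hC : ∀ p ∈ GS, ∃ w, (H p.1, H p.2 + w) ∈ GS ∧ ‖w‖ ≤ k * (‖p.2‖ + ‖p.1‖))
    {ν : ℝ} (hν : |ν| = 1) {p q : E × E} (hp : p ∈ GS) (hq : q ∈ GS) {b : ℝ}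
    (hb : ‖q.2 - Complex.I • H q.1 - (Complex.I * ν) • p.1‖
      + ‖p.2 + Complex.I • H p.1 - (Complex.I * ν) • q.1‖ ≤ b) :
    (‖p.1‖ ≤ b ∧ ‖p.2‖ ≤ 2 * (k + 3) * b) ∧ (‖q.1‖ ≤ b ∧ ‖q.2‖ ≤ 2 * (k + 3) * b) := by
  obtain ⟨hp1, hq1⟩ := norm_pair_le_norm_sub_I_smul (inner_pair_eq hS hH hp hq) hν
  replace hp1 := hp1.trans hb
  replace hq1 := hq1.trans hb
  have hnI : ∀ x : E, ‖(Complex.I * (ν : ℂ)) • x‖ = ‖x‖ := fun x => by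
    rw [norm_smul, norm_mul, Complex.norm_I, Complex.norm_real, Real.norm_eq_abs, hν, one_mul,
      one_mul]
  have hcom := fun p hp => norm_inner_sub_inner_le hS hH hC (p := p) hp
  have h1 := norm_le_of_commutator_le (σ := Complex.I) (by simp) Complex.I_mul_I hk (hcom p hp)
  have h2 := norm_le_of_commutator_le (σ := -Complex.I) (by simp)
    (by rw [neg_mul_neg]; exact Complex.I_mul_I) hk (hcom q hq)
  have h3 : ‖p.2 + Complex.I • H p.1‖ ≤ b + b := by
    have := norm_add_le (p.2 + Complex.I • H p.1 - (Complex.I * ν) • q.1) ((Complex.I * ν) • q.1)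
    rw [sub_add_cancel, hnI] at this
    linarith [norm_nonneg (q.2 - Complex.I • H q.1 - (Complex.I * ν) • p.1)]
  have h4 : ‖q.2 + -Complex.I • H q.1‖ ≤ b + b := by
    have := norm_add_le (q.2 - Complex.I • H q.1 - (Complex.I * ν) • p.1) ((Complex.I * ν) • p.1)
    rw [sub_add_cancel, hnI] at this
    rw [neg_smul, ← sub_eq_add_neg]
    linarith [norm_nonneg (p.2 + Complex.I • H p.1 - (Complex.I * ν) • q.1)]
  have h5 := mul_le_mul_of_nonneg_left hp1 (by linarith : 0 ≤ k + 1)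
  have h6 := mul_le_mul_of_nonneg_left hq1 (by linarith : 0 ≤ k + 1)
  exact ⟨⟨hp1, by linarith⟩, ⟨hq1, by linarith⟩⟩

variable [CompleteSpace E]

/-- For bounded symmetric `H` the operator `[[0, S - i H], [S + i H, 0]] - i ν` is onto. -/
theorem exists_offDiagonal_solution {GS : Submodule ℂ (E × E)} {H : E →L[ℂ] E}
    (hS : ∀ p ∈ GS, ∀ q ∈ GS, inner A p.2 q.1 = inner A p.1 q.2)
    (hsurj : ∀ μ : ℝ, |μ| = 1 → ∀ f, ∃ p ∈ GS, p.2 - (Complex.I * μ) • p.1 = f)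
    (hH : ∀ x y, inner A (H x) y = inner A x (H y)) {ν : ℝ} (hν : |ν| = 1) (f g : E) :
    ∃ p ∈ GS, ∃ q ∈ GS, q.2 - Complex.I • H q.1 - (Complex.I * ν) • p.1 = f ∧
      p.2 + Complex.I • H p.1 - (Complex.I * ν) • q.1 = g := by
  -- `G` is the graph of `[[0, S], [S, 0]]` and `Q = [[0, -i H], [i H, 0]]`.
  let e : C⋆ᵐᵒᵈ(A, E × E) ≃L[ℂ] E × E := WithCStarModule.equivL ℂ
  let G : Submodule ℂ (C⋆ᵐᵒᵈ(A, E × E) × C⋆ᵐᵒᵈ(A, E × E)) :=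
    { carrier := {z | (z.1.1, z.2.2) ∈ GS ∧ (z.1.2, z.2.1) ∈ GS}
      zero_mem' := ⟨GS.zero_mem, GS.zero_mem⟩
      add_mem' := fun ha hb => ⟨GS.add_mem ha.1 hb.1, GS.add_mem ha.2 hb.2⟩
      smul_mem' := fun c _ ha => ⟨GS.smul_mem c ha.1, GS.smul_mem c ha.2⟩ }
  let Q : C⋆ᵐᵒᵈ(A, E × E) →L[ℂ] C⋆ᵐᵒᵈ(A, E × E) :=
    (e.symm : E × E →L[ℂ] C⋆ᵐᵒᵈ(A, E × E)).comp
      ((((-Complex.I) • H.comp (ContinuousLinearMap.snd ℂ E E)).prod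
        (Complex.I • H.comp (ContinuousLinearMap.fst ℂ E E))).comp
          (e : C⋆ᵐᵒᵈ(A, E × E) →L[ℂ] E × E))
  let P : C⋆ᵐᵒᵈ(A, E × E) →L[ℂ] C⋆ᵐᵒᵈ(A, E × E) :=
    (-(Complex.I * (ν : ℂ))) • (1 : C⋆ᵐᵒᵈ(A, E × E) →L[ℂ] C⋆ᵐᵒᵈ(A, E × E))
  have hb : ∀ t : ℝ, 0 ≤ t → t ≤ 1 → ∀ z ∈ G,
      1 * ‖z.1‖ ≤ ‖z.2 + (P + (t : ℂ) • Q) z.1‖ := by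
    intro t _ _ z hz
    have hHt : ∀ x y, inner A ((t : ℂ) • H x) y = inner A x ((t : ℂ) • H y) := fun x y => by
      simp [hH]
    have h := norm_le_norm_sub_I_smul (A := A) (x := z.1)
      (y := (WithCStarModule.equiv A (E × E)).symm
        (z.2.1 - Complex.I • (t : ℂ) • H z.1.2, z.2.2 + Complex.I • (t : ℂ) • H z.1.1))
      (inner_pair_eq (H := fun x => (t : ℂ) • H x) hS hHt hz.1 hz.2) ν
    rw [hν] at h
    refine h.trans_eq (congrArg norm ?_)
    refine (WithCStarModule.equiv A (E × E)).injective (Prod.ext ?_ ?_)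
    · change z.2.1 - Complex.I • (t : ℂ) • H z.1.2 - (Complex.I * ν) • z.1.1
        = z.2.1 + (-(Complex.I * (ν : ℂ)) • z.1.1 + (t : ℂ) • (-Complex.I) • H z.1.2)
      module
    · change z.2.2 + Complex.I • (t : ℂ) • H z.1.1 - (Complex.I * ν) • z.1.2
        = z.2.2 + (-(Complex.I * (ν : ℂ)) • z.1.2 + (t : ℂ) • Complex.I • H z.1.1)
      module
  -- For `H = 0` the substitution `u ± v` decouples the system.
  have hs : ∀ z, ∃ w ∈ G, w.2 + P w.1 = z := by
    intro z
    obtain ⟨p, hp, hpz⟩ := hsurj ν hν (z.1 + z.2)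
    obtain ⟨q, hq, hqz⟩ := hsurj (-ν) (by rwa [abs_neg]) (z.2 - z.1)
    have h1 := GS.smul_mem (1 / 2 : ℂ) (GS.add_mem hp hq)
    have h2 := GS.smul_mem (1 / 2 : ℂ) (GS.sub_mem hp hq)
    refine ⟨((WithCStarModule.equiv A (E × E)).symm
        ((1 / 2 : ℂ) • (p.1 + q.1), (1 / 2 : ℂ) • (p.1 - q.1)),
      (WithCStarModule.equiv A (E × E)).symm
        ((1 / 2 : ℂ) • (p.2 - q.2), (1 / 2 : ℂ) • (p.2 + q.2))), ⟨h1, h2⟩, ?_⟩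
    push_cast at hqz
    refine (WithCStarModule.equiv A (E × E)).injective (Prod.ext ?_ ?_)
    · change (1 / 2 : ℂ) • (p.2 - q.2) + (-(Complex.I * (ν : ℂ))) • (1 / 2 : ℂ) • (p.1 + q.1)
        = z.1
      linear_combination (norm := module) (1 / 2 : ℂ) • hpz - (1 / 2 : ℂ) • hqz
    · change (1 / 2 : ℂ) • (p.2 + q.2) + (-(Complex.I * (ν : ℂ))) • (1 / 2 : ℂ) • (p.1 - q.1)
        = z.2
      linear_combination (norm := module) (1 / 2 : ℂ) • hpz + (1 / 2 : ℂ) • hqz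
  obtain ⟨z, hz, hzf⟩ := surjective_add_of_path one_pos hb hs
    ((WithCStarModule.equiv A (E × E)).symm (f, g))
  refine ⟨_, hz.1, _, hz.2, ?_, ?_⟩
  · rw [show f = z.2.1 + (-(Complex.I * (ν : ℂ)) • z.1.1 + (-Complex.I) • H z.1.2) from
      (congrArg (fun a : C⋆ᵐᵒᵈ(A, E × E) => a.1) hzf).symm]
    module
  · rw [show g = z.2.2 + (-(Complex.I * (ν : ℂ)) • z.1.2 + Complex.I • H z.1.1) from
      (congrArg (fun a : C⋆ᵐᵒᵈ(A, E × E) => a.2) hzf).symm]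
    module

end Energy

/-! ### Bounded approximations of `T` -/

section Approximation

variable {E : Type*} [NormedAddCommGroup E] [NormedSpace ℂ E]

/-- `T (1 + T² / n²)⁻¹`, written in terms of the smoothing operators `K`, `K'` of parameters
`n`, `-n`. -/
noncomputable def boundedApprox (n : ℝ) (K K' : E →L[ℂ] E) : E →L[ℂ] E :=
  (Complex.I * n / 2) • (K - K')

/-- `(1 + T² / n²)⁻¹`, written in terms of the smoothing operators `K`, `K'` of parameters
`n`, `-n`. -/
noncomputable def quadraticSmoothing (K K' : E →L[ℂ] E) : E →L[ℂ] E := (1 / 2 : ℂ) • (K + K')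

theorem boundedApprox_apply (n : ℝ) (K K' : E →L[ℂ] E) (x : E) :
    boundedApprox n K K' x = (Complex.I * n / 2) • (K x - K' x) := rfl

theorem quadraticSmoothing_apply (K K' : E →L[ℂ] E) (x : E) :
    quadraticSmoothing K K' x = (1 / 2 : ℂ) • (K x + K' x) := rfl

namespace IsSmoothing

variable {GT GS : Submodule ℂ (E × E)} {n : ℝ} {K K' : E →L[ℂ] E}

/-- `T (1 + T² / n²)⁻¹` is the composition of `T` with `(1 + T² / n²)⁻¹`. -/
theorem quadraticSmoothing_mem (hK : IsSmoothing GT n K) (hK' : IsSmoothing GT (-n) K') (x : E) :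
    (quadraticSmoothing K K' x, boundedApprox n K K' x) ∈ GT := by
  have := GT.smul_mem (1 / 2 : ℂ) (GT.add_mem (hK.mem x) (hK'.mem x))
  convert! this using 1
  refine Prod.ext rfl ?_
  change (Complex.I * n / 2) • (K x - K' x) = (1 / 2 : ℂ) • (-(Complex.I * (n : ℂ)) • (x - K x)
    + -(Complex.I * ((-n : ℝ) : ℂ)) • (x - K' x))
  push_cast
  module

theorem boundedApprox_fst (hn : n ≠ 0) (hK : IsSmoothing GT n K) (hK' : IsSmoothing GT (-n) K')
    {p : E × E} (hp : p ∈ GT) : boundedApprox n K K' p.1 = quadraticSmoothing K K' p.2 := by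
  rw [boundedApprox_apply, quadraticSmoothing_apply, hK.apply_snd hn hp,
    hK'.apply_snd (neg_ne_zero.2 hn) hp]
  push_cast
  module

theorem inner_boundedApprox {A : Type*} [NonUnitalCStarAlgebra A] [PartialOrder A]
    [SMul A E] [CStarModule A E]
    (hT : ∀ p ∈ GT, ∀ q ∈ GT, inner A p.2 q.1 = inner A p.1 q.2) (hn : n ≠ 0)
    (hK : IsSmoothing GT n K) (hK' : IsSmoothing GT (-n) K') (x y : E) :
    inner A (boundedApprox n K K' x) y = inner A x (boundedApprox n K K' y) := by
  have h1 := inner_apply_left hT hn hK hK' x y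
  have h2 := inner_apply_left hT (neg_ne_zero.2 hn) hK' (by rwa [neg_neg]) x y
  have e : star (Complex.I * (n : ℂ) / 2) = -(Complex.I * n / 2) := by simp [neg_div]
  simp only [boundedApprox_apply, CStarModule.inner_smul_left_complex,
    CStarModule.inner_smul_right_complex, CStarModule.inner_sub_left,
    CStarModule.inner_sub_right, h1, h2, e]
  module

section Commutator

variable {C C' : E →L[ℂ] E} {k : ℝ}

/-- `[S, T (1 + T² / n²)⁻¹]` is bounded relative to `S`, uniformly in `n`. -/
theorem boundedApprox_commutator (hn : n ≠ 0) (hC : ∀ x, ‖C x‖ ≤ k * ‖x‖)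
    (hC' : ∀ x, ‖C' x‖ ≤ k * ‖x‖)
    (hm : ∀ p ∈ GS, (K p.1, K p.2 - (Complex.I / n) • C (p.2 - Complex.I • p.1)) ∈ GS)
    (hm' : ∀ p ∈ GS,
      (K' p.1, K' p.2 - (Complex.I / (-n : ℝ)) • C' (p.2 - Complex.I • p.1)) ∈ GS)
    (hk : 0 ≤ k) {p : E × E} (hp : p ∈ GS) :
    ∃ w, (boundedApprox n K K' p.1, boundedApprox n K K' p.2 + w) ∈ GS ∧
      ‖w‖ ≤ k * (‖p.2‖ + ‖p.1‖) := by
  have hs : ‖p.2 - Complex.I • p.1‖ ≤ ‖p.2‖ + ‖p.1‖ := by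
    refine (_root_.norm_sub_le _ _).trans_eq ?_
    rw [norm_smul, Complex.norm_I, one_mul]
  set s := p.2 - Complex.I • p.1
  refine ⟨(1 / 2 : ℂ) • (C s + C' s), ?_, ?_⟩
  · have := GS.smul_mem (Complex.I * n / 2) (GS.sub_mem (hm p hp) (hm' p hp))
    convert! this using 1
    refine Prod.ext rfl ?_
    have e := I_mul_mul_I_div hn
    change (Complex.I * n / 2) • (K p.2 - K' p.2) + (1 / 2 : ℂ) • (C s + C' s)
      = (Complex.I * n / 2) • (K p.2 - (Complex.I / n) • C s
        - (K' p.2 - (Complex.I / (-n : ℝ)) • C' s))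
    push_cast
    rw [div_neg]
    linear_combination (norm := module) (1 / 2 : ℂ) • e • (C s + C' s)
  · calc ‖(1 / 2 : ℂ) • (C s + C' s)‖ = 1 / 2 * ‖C s + C' s‖ := by rw [norm_smul]; norm_num
      _ ≤ 1 / 2 * (k * ‖s‖ + k * ‖s‖) := by
          gcongr
          exact (norm_add_le _ _).trans (add_le_add (hC s) (hC' s))
      _ = k * ‖s‖ := by ring
      _ ≤ _ := by gcongr

/-- `[S, (1 + T² / n²)⁻¹]` is bounded relative to `S`, with bound of order `n⁻¹`. -/
theorem quadraticSmoothing_commutator (hn : 0 < n) (hC : ∀ x, ‖C x‖ ≤ k * ‖x‖)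
    (hC' : ∀ x, ‖C' x‖ ≤ k * ‖x‖)
    (hm : ∀ p ∈ GS, (K p.1, K p.2 - (Complex.I / n) • C (p.2 - Complex.I • p.1)) ∈ GS)
    (hm' : ∀ p ∈ GS,
      (K' p.1, K' p.2 - (Complex.I / (-n : ℝ)) • C' (p.2 - Complex.I • p.1)) ∈ GS)
    (hk : 0 ≤ k) {p : E × E} (hp : p ∈ GS) :
    ∃ w, (quadraticSmoothing K K' p.1, quadraticSmoothing K K' p.2 + w) ∈ GS ∧
      ‖w‖ ≤ k * (‖p.2‖ + ‖p.1‖) / n := by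
  have hs : ‖p.2 - Complex.I • p.1‖ ≤ ‖p.2‖ + ‖p.1‖ := by
    refine (_root_.norm_sub_le _ _).trans_eq ?_
    rw [norm_smul, Complex.norm_I, one_mul]
  set s := p.2 - Complex.I • p.1
  refine ⟨-((Complex.I / n) • (1 / 2 : ℂ) • (C s - C' s)), ?_, ?_⟩
  · have := GS.smul_mem (1 / 2 : ℂ) (GS.add_mem (hm p hp) (hm' p hp))
    convert! this using 1
    refine Prod.ext rfl ?_
    change (1 / 2 : ℂ) • (K p.2 + K' p.2) + -((Complex.I / n) • (1 / 2 : ℂ) • (C s - C' s))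
      = (1 / 2 : ℂ) • (K p.2 - (Complex.I / n) • C s
        + (K' p.2 - (Complex.I / (-n : ℝ)) • C' s))
    push_cast
    rw [div_neg]
    module
  · calc ‖-((Complex.I / (n : ℂ)) • (1 / 2 : ℂ) • (C s - C' s))‖
          = 1 / 2 * ‖C s - C' s‖ / n := by
          rw [norm_neg, norm_smul, norm_smul, norm_div, Complex.norm_I, Complex.norm_real,
            Real.norm_eq_abs, abs_of_pos hn, one_div_mul_eq_div]
          norm_num
      _ ≤ 1 / 2 * (k * ‖s‖ + k * ‖s‖) / n := by
          gcongr
          exact (_root_.norm_sub_le _ _).trans (add_le_add (hC s) (hC' s))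
      _ = k * ‖s‖ / n := by ring
      _ ≤ _ := by gcongr

end Commutator

theorem boundedApprox_comm {K₀ : E →L[ℂ] E} {m : ℝ} (hn : n ≠ 0) (hm : m ≠ 0)
    (hK : IsSmoothing GT n K) (hK' : IsSmoothing GT (-n) K') (hK₀ : IsSmoothing GT m K₀) (x : E) :
    K₀ (boundedApprox n K K' x) = boundedApprox n K K' (K₀ x) := by
  rw [boundedApprox_apply, boundedApprox_apply, map_smul, map_sub, hK₀.apply_comm hm hK hn,
    hK₀.apply_comm hm hK' (neg_ne_zero.2 hn)]

/-- Bootstrapping: if `f`, `g` lie in `dom T`, then applying `T K` to the solution `(u, v)` of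
`(D - i ν) (u, v) = (f, g)` solves an equation with data bounded independently of `K` and `H`.
The a priori bounds then show that `u`, `S u`, `v`, `S v` are close to their smoothings. -/
theorem norm_sub_le_of_solution {A : Type*} [NonUnitalCStarAlgebra A] [PartialOrder A]
    [StarOrderedRing A] [SMul A E] [CStarModule A E] {m : ℝ} (hm : m ≠ 0)
    (hK : IsSmoothing GT m K) {H : E →L[ℂ] E}
    (hS : ∀ p ∈ GS, ∀ q ∈ GS, inner A p.2 q.1 = inner A p.1 q.2)
    (hH : ∀ x y, inner A (H x) y = inner A x (H y)) {k : ℝ} (hk : 0 ≤ k)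
    (hHC : ∀ p ∈ GS, ∃ w, (H p.1, H p.2 + w) ∈ GS ∧ ‖w‖ ≤ k * (‖p.2‖ + ‖p.1‖))
    (hKH : ∀ x, K (H x) = H (K x)) {C : E →L[ℂ] E} (hC : ∀ x, ‖C x‖ ≤ k * ‖x‖)
    (hCm : ∀ p ∈ GS, (K p.1, K p.2 - (Complex.I / m) • C (p.2 - Complex.I • p.1)) ∈ GS)
    {ν : ℝ} (hν : |ν| = 1) {p q f g : E × E} (hp : p ∈ GS) (hq : q ∈ GS) (hf : f ∈ GT)
    (hg : g ∈ GT) (hpq : q.2 - Complex.I • H q.1 - (Complex.I * ν) • p.1 = f.1)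
    (hqp : p.2 + Complex.I • H p.1 - (Complex.I * ν) • q.1 = g.1) {W B : ℝ}
    (hW : k * ((2 * (k + 3) + 1) * (‖f.1‖ + ‖g.1‖)) ≤ W)
    (hB : 2 * (k + 3) * (‖f.2‖ + ‖g.2‖ + 2 * W) + W ≤ B) :
    (‖p.1 - K p.1‖ ≤ B / |m| ∧ ‖p.2 - K p.2‖ ≤ B / |m|) ∧
      (‖q.1 - K q.1‖ ≤ B / |m| ∧ ‖q.2 - K q.2‖ ≤ B / |m|) := by
  have hm' : 0 < |m| := abs_pos.2 hm
  have e := I_mul_mul_I_div hm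
  obtain ⟨⟨hp1, hp2⟩, hq1, hq2⟩ := norm_le_of_commutator_bound hS hH hk hHC hν hp hq
    (b := ‖f.1‖ + ‖g.1‖) (by rw [hpq, hqp])
  -- `L = T K`, which commutes with `H`.
  set L : E → E := fun x => -(Complex.I * (m : ℂ)) • (x - K x) with hL
  have hLn : ∀ x b, ‖L x‖ ≤ b → ‖x - K x‖ ≤ b / |m| := fun x b h => by
    rw [le_div_iff₀ hm', mul_comm]
    rwa [hL, norm_smul, norm_neg, norm_mul, Complex.norm_I, Complex.norm_real, one_mul,
      Real.norm_eq_abs] at h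
  have hLT : ∀ f ∈ GT, ‖L f.1‖ ≤ ‖f.2‖ := fun f hf => by
    change ‖-(Complex.I * (m : ℂ)) • (f.1 - K f.1)‖ ≤ ‖f.2‖
    rw [← hK.apply_snd hm hf]
    exact hK.norm_apply_le _
  have hmem : ∀ p ∈ GS, (L p.1, L p.2 + C (p.2 - Complex.I • p.1)) ∈ GS := by
    intro p hp
    have := GS.smul_mem (-(Complex.I * (m : ℂ))) (GS.sub_mem hp (hCm p hp))
    convert! this using 1
    refine Prod.ext rfl ?_
    change -(Complex.I * (m : ℂ)) • (p.2 - K p.2) + C (p.2 - Complex.I • p.1)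
      = -(Complex.I * (m : ℂ)) • (p.2 - (K p.2 - (Complex.I / m) • C (p.2 - Complex.I • p.1)))
    linear_combination (norm := module) e • C (p.2 - Complex.I • p.1)
  have hCs : ∀ p : E × E, ‖p.1‖ ≤ ‖f.1‖ + ‖g.1‖ → ‖p.2‖ ≤ 2 * (k + 3) * (‖f.1‖ + ‖g.1‖) →
      ‖C (p.2 - Complex.I • p.1)‖ ≤ W := by
    intro p h1 h2
    refine (hC _).trans (le_trans ?_ hW)
    gcongr
    refine (_root_.norm_sub_le _ _).trans ?_
    rw [norm_smul, Complex.norm_I, one_mul]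
    linarith
  have hCp := hCs p hp1 hp2
  have hCq := hCs q hq1 hq2
  have e1 : L q.2 + C (q.2 - Complex.I • q.1) - Complex.I • H (L q.1) - (Complex.I * ν) • L p.1
      = L f.1 + C (q.2 - Complex.I • q.1) := by
    simp only [hL, ← hpq, map_sub, map_smul, hKH]
    module
  have e2 : L p.2 + C (p.2 - Complex.I • p.1) + Complex.I • H (L p.1) - (Complex.I * ν) • L q.1
      = L g.1 + C (p.2 - Complex.I • p.1) := by
    simp only [hL, ← hqp, map_sub, map_add, map_smul, hKH]
    module
  -- `(L u, L v)` solves the equation with data `L f + [S, L] v`, `L g + [S, L] u`.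
  obtain ⟨⟨h1, h2⟩, h3, h4⟩ := norm_le_of_commutator_bound hS hH hk hHC hν (hmem p hp) (hmem q hq)
    (b := ‖f.2‖ + ‖g.2‖ + 2 * W) (by
      simp only [e1, e2]
      have := norm_add_le (L f.1) (C (q.2 - Complex.I • q.1))
      have := norm_add_le (L g.1) (C (p.2 - Complex.I • p.1))
      linarith [hLT f hf, hLT g hg])
  have hW0 : 0 ≤ W := (norm_nonneg _).trans hCp
  have hB1 : ‖f.2‖ + ‖g.2‖ + 2 * W ≤ B := by
    refine le_trans ?_ hB
    nlinarith [norm_nonneg f.2, norm_nonneg g.2]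
  have hsub : ∀ x y : E, ‖x‖ ≤ ‖x + y‖ + ‖y‖ := fun x y => by
    simpa using _root_.norm_sub_le (x + y) y
  refine ⟨⟨hLn _ _ (h1.trans hB1), hLn _ _ ?_⟩, hLn _ _ (h3.trans hB1), hLn _ _ ?_⟩
  · exact (hsub _ _).trans ((add_le_add h2 hCp).trans hB)
  · exact (hsub _ _).trans ((add_le_add h4 hCq).trans hB)

end IsSmoothing

end Approximation

/-! ### Approximate solutions and the commutator estimate for `S` and `T` -/

section GraphPair

variable {A E : Type*} [NonUnitalCStarAlgebra A] [PartialOrder A] [StarOrderedRing A]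
  [NormedAddCommGroup E] [NormedSpace ℂ E] [SMul A E] [CStarModule A E] [CompleteSpace E]

/-- The graphs `GS`, `GT` of symmetric operators `S`, `T`, together with `R = (S - i)⁻¹`, the
smoothing operators of `T` and a bounded operator `X` with `T R = R T + R X`, that is
`[S, T] = X (S - i)` on the range of `R` restricted to `dom T`. -/
structure IsWeaklyCommutingPair (A : Type*) [NonUnitalCStarAlgebra A] [PartialOrder A]
    [SMul A E] [CStarModule A E] (GS GT : Submodule ℂ (E × E)) (R X : E →L[ℂ] E) : Prop where
  symm_left : ∀ p ∈ GS, ∀ q ∈ GS, inner A p.2 q.1 = inner A p.1 q.2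
  symm_right : ∀ p ∈ GT, ∀ q ∈ GT, inner A p.2 q.1 = inner A p.1 q.2
  resolvent_mem : ∀ s, (R s, s + Complex.I • R s) ∈ GS
  resolvent_apply : ∀ p ∈ GS, R (p.2 - Complex.I • p.1) = p.1
  surjective : ∀ μ : ℝ, |μ| = 1 → ∀ f, ∃ p ∈ GS, p.2 - (Complex.I * μ) • p.1 = f
  exists_isSmoothing : ∀ m : ℝ, m ≠ 0 → ∃ K : E →L[ℂ] E, IsSmoothing GT m K
  resolvent_comm : ∀ p ∈ GT, (R p.1, R p.2 + R (X p.1)) ∈ GT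

namespace IsWeaklyCommutingPair

variable {GS GT : Submodule ℂ (E × E)} {R X : E →L[ℂ] E}

/-- `D - i ν` has approximate solutions for data in `dom T`: solve the equation with `T` replaced by
the bounded `H = T (1 + T² / n²)⁻¹`, and apply `M = (1 + T² / n²)⁻¹` to the solution `(u, v)`. Since
`T M = H`, the new error consists of `(M - 1) S`, `M - 1` and `[S, M]` applied to `u`, `v`, all of
which are of order `n⁻¹`. -/
theorem exists_approximate_solution (h : IsWeaklyCommutingPair A GS GT R X) {ν : ℝ}
    (hν : |ν| = 1) {f g : E × E} (hf : f ∈ GT) (hg : g ∈ GT) {δ : ℝ} (hδ : 0 < δ) :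
    ∃ p ∈ GS, ∃ q ∈ GS, ∃ a b, (p.1, a) ∈ GT ∧ (q.1, b) ∈ GT ∧
      ‖q.2 - Complex.I • b - (Complex.I * ν) • p.1 - f.1‖ ≤ δ ∧
      ‖p.2 + Complex.I • a - (Complex.I * ν) • q.1 - g.1‖ ≤ δ := by
  set k := 2 * ‖X‖ with hkdef
  have hk : 0 ≤ k := by positivity
  set W := k * ((2 * (k + 3) + 1) * (‖f.1‖ + ‖g.1‖)) with hW
  have hW0 : 0 ≤ W := by positivity
  set B := 2 * (k + 3) * (‖f.2‖ + ‖g.2‖ + 2 * W) + W with hB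
  have hB0 : 0 ≤ B := by positivity
  obtain ⟨n, hn0, hnk, hnδ⟩ : ∃ n : ℝ, 0 < n ∧ k ≤ n ∧ (2 * B + W) / δ ≤ n :=
    ⟨k + (2 * B + W) / δ + 1, by positivity,
      by linarith [show 0 ≤ (2 * B + W) / δ by positivity], by linarith⟩
  have hn : n ≠ 0 := hn0.ne'
  obtain ⟨K, hK⟩ := h.exists_isSmoothing n hn
  obtain ⟨K', hK'⟩ := h.exists_isSmoothing (-n) (neg_ne_zero.2 hn)
  obtain ⟨C, hC, hCm⟩ := hK.exists_commutator hn h.resolvent_mem h.resolvent_apply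
    h.resolvent_comm (by rwa [abs_of_pos hn0])
  obtain ⟨C', hC', hCm'⟩ := hK'.exists_commutator (neg_ne_zero.2 hn) h.resolvent_mem
    h.resolvent_apply h.resolvent_comm (by rwa [abs_neg, abs_of_pos hn0])
  set H := boundedApprox n K K'
  have hH := IsSmoothing.inner_boundedApprox h.symm_right hn hK hK'
  have hHC := fun p (hp : p ∈ GS) =>
    IsSmoothing.boundedApprox_commutator hn hC hC' hCm hCm' hk hp
  obtain ⟨p, hp, q, hq, hpq, hqp⟩ :=
    exists_offDiagonal_solution h.symm_left h.surjective hH hν f.1 g.1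
  obtain ⟨⟨hp1, hp2⟩, hq1, hq2⟩ := norm_le_of_commutator_bound h.symm_left hH hk hHC hν hp hq
    (b := ‖f.1‖ + ‖g.1‖) (by rw [hpq, hqp])
  have hb := hK.norm_sub_le_of_solution hn h.symm_left hH hk hHC
    (IsSmoothing.boundedApprox_comm hn hn hK hK' hK) hC hCm hν hp hq hf hg hpq hqp
    hW.ge hB.ge
  have hb' := hK'.norm_sub_le_of_solution (neg_ne_zero.2 hn) h.symm_left hH hk hHC
    (IsSmoothing.boundedApprox_comm hn (neg_ne_zero.2 hn) hK hK' hK') hC' hCm' hν hp hq hf hg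
    hpq hqp hW.ge hB.ge
  rw [abs_of_pos hn0] at hb
  rw [abs_neg, abs_of_pos hn0] at hb'
  set M := quadraticSmoothing K K' with hM
  have hMn : ∀ x c, ‖x - K x‖ ≤ c → ‖x - K' x‖ ≤ c → ‖M x - x‖ ≤ c := by
    intro x c h1 h2
    have e : M x - x = -((1 / 2 : ℂ) • ((x - K x) + (x - K' x))) := by
      rw [hM, quadraticSmoothing_apply]
      module
    rw [e, norm_neg, norm_smul]
    have := norm_add_le (x - K x) (x - K' x)
    norm_num
    linarith
  obtain ⟨w, hw, hwn⟩ := IsSmoothing.quadraticSmoothing_commutator hn0 hC hC' hCm hCm' hk hp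
  obtain ⟨z, hz, hzn⟩ := IsSmoothing.quadraticSmoothing_commutator hn0 hC hC' hCm hCm' hk hq
  have hWn : ∀ x : E × E, ‖x.1‖ ≤ ‖f.1‖ + ‖g.1‖ → ‖x.2‖ ≤ 2 * (k + 3) * (‖f.1‖ + ‖g.1‖) →
      k * (‖x.2‖ + ‖x.1‖) / n ≤ W / n := by
    intro x h1 h2
    rw [hW]
    gcongr
    linarith
  have hnI : ∀ x : E, ‖(Complex.I * (ν : ℂ)) • x‖ = ‖x‖ := fun x => by
    rw [norm_smul, norm_mul, Complex.norm_I, Complex.norm_real, Real.norm_eq_abs, hν, one_mul,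
      one_mul]
  have hfin : B / n + W / n + B / n ≤ δ := by
    rw [← add_div, ← add_div, div_le_iff₀ hn0]
    rw [div_le_iff₀ hδ] at hnδ
    linarith
  refine ⟨_, hw, _, hz, H p.1, H q.1, hK.quadraticSmoothing_mem hK' p.1,
    hK.quadraticSmoothing_mem hK' q.1, ?_, ?_⟩
  · have e : M q.2 + z - Complex.I • H q.1 - (Complex.I * ν) • M p.1 - f.1
        = (M q.2 - q.2) + z - (Complex.I * (ν : ℂ)) • (M p.1 - p.1) := by
      rw [← hpq]
      module
    simp only [← hM, e]
    refine (norm_sub_le _ _).trans ((add_le_add (norm_add_le _ _) le_rfl).trans ?_)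
    rw [hnI]
    exact (add_le_add (add_le_add (hMn _ _ hb.2.2 hb'.2.2) (hzn.trans (hWn q hq1 hq2)))
      (hMn _ _ hb.1.1 hb'.1.1)).trans hfin
  · have e : M p.2 + w + Complex.I • H p.1 - (Complex.I * ν) • M q.1 - g.1
        = (M p.2 - p.2) + w - (Complex.I * (ν : ℂ)) • (M q.1 - q.1) := by
      rw [← hqp]
      module
    simp only [← hM, e]
    refine (norm_sub_le _ _).trans ((add_le_add (norm_add_le _ _) le_rfl).trans ?_)
    rw [hnI]
    exact (add_le_add (add_le_add (hMn _ _ hb.1.2 hb'.1.2) (hwn.trans (hWn p hp1 hp2)))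
      (hMn _ _ hb.2.1 hb'.2.1)).trans hfin

/-- The commutator bound for `T` itself, as a limit of the bounds for `T (1 + T² / n²)⁻¹`. -/
theorem norm_inner_sub_inner_le (h : IsWeaklyCommutingPair A GS GT R X)
    (hd : Dense {x | ∃ y, (x, y) ∈ GT}) {x s t : E} (hs : (x, s) ∈ GS) (ht : (x, t) ∈ GT) :
    ‖inner A s t - inner A t s‖ ≤ 2 * ‖X‖ * ‖x‖ * (‖s‖ + ‖x‖) := by
  have hcl : IsClosed {t : E | ‖inner A s t - inner A t s‖ ≤ 2 * ‖X‖ * ‖x‖ * (‖s‖ + ‖x‖)} := by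
    have h1 : Continuous fun t : E => inner A s t :=
      CStarModule.continuous_inner.comp (continuous_const.prodMk continuous_id)
    have h2 : Continuous fun t : E => inner A t s :=
      CStarModule.continuous_inner.comp (continuous_id.prodMk continuous_const)
    exact isClosed_le (h1.sub h2).norm continuous_const
  refine hcl.closure_subset (Metric.mem_closure_iff.2 fun ε hε => ?_)
  obtain ⟨y, hdist, y', hy⟩ := Metric.dense_iff.1 hd t (ε / 4) (by positivity)
  rw [Metric.mem_ball, dist_comm, dist_eq_norm] at hdist
  set n := 2 * ‖X‖ + 4 * ‖y'‖ / ε + 1 with hndef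
  have hn0 : 0 < n := by positivity
  have hn : n ≠ 0 := hn0.ne'
  have hnX : 2 * ‖X‖ ≤ n := by
    have : 0 ≤ 4 * ‖y'‖ / ε := by positivity
    linarith
  have hny : ‖y'‖ / n < ε / 2 := by
    have h1 : 4 * ‖y'‖ / ε < n := by linarith [norm_nonneg X]
    rw [div_lt_iff₀ hε] at h1
    rw [div_lt_iff₀ hn0]
    linarith [norm_nonneg y', mul_pos hε hn0]
  obtain ⟨K, hK⟩ := h.exists_isSmoothing n hn
  obtain ⟨K', hK'⟩ := h.exists_isSmoothing (-n) (neg_ne_zero.2 hn)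
  obtain ⟨C, hC, hCm⟩ := hK.exists_commutator hn h.resolvent_mem h.resolvent_apply
    h.resolvent_comm (by rwa [abs_of_pos hn0])
  obtain ⟨C', hC', hCm'⟩ := hK'.exists_commutator (neg_ne_zero.2 hn) h.resolvent_mem
    h.resolvent_apply h.resolvent_comm (by rwa [abs_neg, abs_of_pos hn0])
  refine ⟨boundedApprox n K K' x, HilbertModule.norm_inner_sub_inner_le h.symm_left
    (IsSmoothing.inner_boundedApprox h.symm_right hn hK hK') (fun p (hp : p ∈ GS) =>
      IsSmoothing.boundedApprox_commutator hn hC hC' hCm hCm' (by positivity) hp) hs, ?_⟩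
  rw [IsSmoothing.boundedApprox_fst hn hK hK' ht, dist_eq_norm, quadraticSmoothing_apply]
  have h1 := hK.norm_sub_le hn hy t
  have h2 := hK'.norm_sub_le (neg_ne_zero.2 hn) hy t
  rw [abs_of_pos hn0] at h1
  rw [abs_neg, abs_of_pos hn0] at h2
  have e : t - (1 / 2 : ℂ) • (K t + K' t) = (1 / 2 : ℂ) • ((t - K t) + (t - K' t)) := by module
  have h3 := norm_add_le (t - K t) (t - K' t)
  rw [e, norm_smul]
  norm_num
  dsimp only at h1 h2
  linarith

/-- `S ± i T` is closed on `dom S ∩ dom T`. -/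
theorem exists_limit (h : IsWeaklyCommutingPair A GS GT R X)
    (hd : Dense {x | ∃ y, (x, y) ∈ GT}) (hS : IsClosed (GS : Set (E × E)))
    (hT : IsClosed (GT : Set (E × E))) {σ : ℂ} (hσ : star σ = -σ) (hσ2 : σ * σ = -1)
    {x s t : ℕ → E} (hs : ∀ n, (x n, s n) ∈ GS) (ht : ∀ n, (x n, t n) ∈ GT) {a y : E}
    (hx : Filter.Tendsto x Filter.atTop (nhds a))
    (hy : Filter.Tendsto (fun n => s n + σ • t n) Filter.atTop (nhds y)) :
    ∃ s' t', (a, s') ∈ GS ∧ (a, t') ∈ GT ∧ s' + σ • t' = y := by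
  -- The commutator estimate makes `s`, where `s n = S (x n)`, a Cauchy sequence.
  have hle : ∀ m n : ℕ, dist (s m) (s n) ≤ 2 * (dist (s m + σ • t m) (s n + σ • t n)
      + (2 * ‖X‖ + 1) * dist (x m) (x n)) := by
    intro m n
    have h1 := norm_le_of_commutator_le hσ hσ2 (by positivity)
      (h.norm_inner_sub_inner_le hd (x := x m - x n) (s := s m - s n) (t := t m - t n)
        (GS.sub_mem (hs m) (hs n)) (GT.sub_mem (ht m) (ht n)))
    rw [dist_eq_norm, dist_eq_norm, dist_eq_norm]
    have e : s m + σ • t m - (s n + σ • t n) = s m - s n + σ • (t m - t n) := by module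
    rw [e]
    exact h1
  have hcau : CauchySeq s := by
    rw [cauchySeq_iff_tendsto_dist_atTop_0]
    refine squeeze_zero (fun _ => dist_nonneg) (fun mn => hle mn.1 mn.2) ?_
    have h1 := cauchySeq_iff_tendsto_dist_atTop_0.1 hy.cauchySeq
    have h2 := cauchySeq_iff_tendsto_dist_atTop_0.1 hx.cauchySeq
    simpa using (h1.add (h2.const_mul (2 * ‖X‖ + 1))).const_mul 2
  obtain ⟨s', hs'⟩ := cauchySeq_tendsto_of_complete hcau
  have ht' : Filter.Tendsto t Filter.atTop (nhds (-σ • (y - s'))) := by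
    have h1 := (hy.sub hs').const_smul (-σ)
    refine h1.congr fun n => ?_
    linear_combination (norm := module) -(hσ2 • t n)
  refine ⟨s', -σ • (y - s'), ?_, ?_, ?_⟩
  · exact hS.mem_of_tendsto (hx.prodMk_nhds hs') (Filter.Eventually.of_forall hs)
  · exact hT.mem_of_tendsto (hx.prodMk_nhds ht') (Filter.Eventually.of_forall ht)
  · linear_combination (norm := module) -(hσ2 • (y - s'))

end IsWeaklyCommutingPair

end GraphPair

/-! ### The sum operator -/

section SumOperator

theorem mem_sumOperator_graph {A E : Type*} [AddCommGroup E] [Module ℂ E] {S T : E →ₗ.[ℂ] E}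
    {z : C⋆ᵐᵒᵈ(A, E × E) × C⋆ᵐᵒᵈ(A, E × E)} :
    z ∈ (sumOperator A S T).graph ↔ ∃ s t r w, (z.1.1, s) ∈ S.graph ∧ (z.1.1, t) ∈ T.graph ∧
      (z.1.2, r) ∈ S.graph ∧ (z.1.2, w) ∈ T.graph ∧
      z.2.1 = r - Complex.I • w ∧ z.2.2 = s + Complex.I • t := by
  constructor
  · intro hz
    obtain ⟨x, hx1, hx2⟩ := (LinearPMap.mem_graph_iff _).1 hz
    obtain ⟨x, hx⟩ := x
    obtain rfl : x = z.1 := hx1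
    obtain ⟨h1, h2⟩ := (mem_sumOperator_domain A S T _).1 hx
    refine ⟨_, _, _, _, S.mem_graph ⟨_, h1.1⟩, T.mem_graph ⟨_, h1.2⟩, S.mem_graph ⟨_, h2.1⟩,
      T.mem_graph ⟨_, h2.2⟩, ?_⟩
    rw [← hx2]
    exact ⟨rfl, rfl⟩
  · rintro ⟨s, t, r, w, hs, ht, hr, hw, h1, h2⟩
    have d1 : z.1.1 ∈ S.domain ⊓ T.domain :=
      ⟨LinearPMap.mem_domain_of_mem_graph hs, LinearPMap.mem_domain_of_mem_graph ht⟩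
    have d2 : z.1.2 ∈ S.domain ⊓ T.domain :=
      ⟨LinearPMap.mem_domain_of_mem_graph hr, LinearPMap.mem_domain_of_mem_graph hw⟩
    refine (LinearPMap.mem_graph_iff _).2 ⟨⟨z.1, d1, d2⟩, rfl, ?_⟩
    refine (sumOperator_apply A S T z.1.1 z.1.2 d1 d2).trans ?_
    rw [← (LinearPMap.image_iff d1.1).2 hs, ← (LinearPMap.image_iff d1.2).2 ht,
      ← (LinearPMap.image_iff d2.1).2 hr, ← (LinearPMap.image_iff d2.2).2 hw, ← h1, ← h2]
    rfl

theorem dense_prod {A E : Type*} [NormedAddCommGroup E] [NormedSpace ℂ E] {s : Set E}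
    (hs : Dense s) :
    Dense {z : C⋆ᵐᵒᵈ(A, E × E) | z.1 ∈ s ∧ z.2 ∈ s} :=
  (hs.prod hs).preimage (WithCStarModule.equivL ℂ (A := A) (E := E × E)).isOpenMap

/-- `dom S ∩ dom T` contains the dense subspace `R (dom T)`. -/
theorem dense_domain_inf {A E : Type*} [NonUnitalCStarAlgebra A] [PartialOrder A]
    [NormedAddCommGroup E] [NormedSpace ℂ E] [SMul A E] [CStarModule A E]
    {S T : E →ₗ.[ℂ] E} {R X : E →L[ℂ] E}
    (h : IsWeaklyCommutingPair A S.graph T.graph R X) (hS : Dense (S.domain : Set E))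
    (hT : Dense (T.domain : Set E)) : Dense ((S.domain ⊓ T.domain : Submodule ℂ E) : Set E) := by
  have hR : DenseRange R := hS.mono fun x hx =>
    ⟨_, h.resolvent_apply _ (S.mem_graph ⟨x, hx⟩)⟩
  refine (hR.dense_image R.continuous hT).mono ?_
  rintro _ ⟨x, hx, rfl⟩
  exact ⟨LinearPMap.mem_domain_of_mem_graph (h.resolvent_mem x),
    LinearPMap.mem_domain_of_mem_graph (h.resolvent_comm _ (T.mem_graph ⟨x, hx⟩))⟩

variable {A E : Type*} [NonUnitalCStarAlgebra A] [PartialOrder A] [StarOrderedRing A]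
  [NormedAddCommGroup E] [NormedSpace ℂ E] [SMul A E] [CStarModule A E]

theorem inner_sumOperator_eq {S T : E →ₗ.[ℂ] E}
    (hS : ∀ p ∈ S.graph, ∀ q ∈ S.graph, inner A p.2 q.1 = inner A p.1 q.2)
    (hT : ∀ p ∈ T.graph, ∀ q ∈ T.graph, inner A p.2 q.1 = inner A p.1 q.2) :
    ∀ p ∈ (sumOperator A S T).graph, ∀ q ∈ (sumOperator A S T).graph,
      inner A p.2 q.1 = inner A p.1 q.2 := by
  intro p hp q hq
  obtain ⟨s, t, r, w, hs, ht, hr, hw, h1, h2⟩ := mem_sumOperator_graph.1 hp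
  obtain ⟨s', t', r', w', hs', ht', hr', hw', h1', h2'⟩ := mem_sumOperator_graph.1 hq
  have e1 : inner A r q.1.1 = inner A p.1.2 s' := hS _ hr _ hs'
  have e2 : inner A s q.1.2 = inner A p.1.1 r' := hS _ hs _ hr'
  have e3 : inner A w q.1.1 = inner A p.1.2 t' := hT _ hw _ ht'
  have e4 : inner A t q.1.2 = inner A p.1.1 w' := hT _ ht _ hw'
  rw [WithCStarModule.prod_inner, WithCStarModule.prod_inner, h1, h2, h1', h2']
  simp only [CStarModule.inner_add_left, CStarModule.inner_add_right, CStarModule.inner_sub_left,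
    CStarModule.inner_sub_right, CStarModule.inner_smul_left_complex,
    CStarModule.inner_smul_right_complex, e1, e2, e3, e4, RCLike.star_def, Complex.conj_I]
  module

variable [CompleteSpace E]

theorem isClosed_sumOperator {S T : E →ₗ.[ℂ] E} {R X : E →L[ℂ] E}
    (h : IsWeaklyCommutingPair A S.graph T.graph R X) (hd : Dense {x | ∃ y, (x, y) ∈ T.graph})
    (hS : S.IsClosed) (hT : T.IsClosed) : (sumOperator A S T).IsClosed := by
  refine IsSeqClosed.isClosed fun z a hz hlim => ?_
  choose s t r w hs ht hr hw h1 h2 using fun n => mem_sumOperator_graph.1 (hz n)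
  have hcont : Continuous fun x : C⋆ᵐᵒᵈ(A, E × E) => (WithCStarModule.equiv A (E × E) x) :=
    (WithCStarModule.equivL ℂ (A := A) (E := E × E)).continuous
  have hc1 : Continuous fun x : C⋆ᵐᵒᵈ(A, E × E) => x.1 := continuous_fst.comp hcont
  have hc2 : Continuous fun x : C⋆ᵐᵒᵈ(A, E × E) => x.2 := continuous_snd.comp hcont
  have l1 : Filter.Tendsto (fun n => (z n).1) Filter.atTop (nhds a.1) :=
    (continuous_fst.tendsto a).comp hlim
  have l2 : Filter.Tendsto (fun n => (z n).2) Filter.atTop (nhds a.2) :=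
    (continuous_snd.tendsto a).comp hlim
  obtain ⟨s', t', hs', ht', e⟩ := h.exists_limit hd hS hT (σ := Complex.I) (by simp)
    Complex.I_mul_I hs ht ((hc1.tendsto _).comp l1)
    (((hc2.tendsto _).comp l2).congr fun n => h2 n)
  obtain ⟨r', w', hr', hw', e'⟩ := h.exists_limit hd hS hT (σ := -Complex.I) (by simp)
    (by rw [neg_mul_neg]; exact Complex.I_mul_I) hr hw ((hc2.tendsto _).comp l1)
    (((hc1.tendsto _).comp l2).congr fun n => by
      rw [neg_smul, ← sub_eq_add_neg]; exact h1 n)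
  rw [neg_smul, ← sub_eq_add_neg] at e'
  exact mem_sumOperator_graph.2 ⟨s', t', r', w', hs', ht', hr', hw', e'.symm, e.symm⟩

theorem dense_range_sumOperator_sub {S T : E →ₗ.[ℂ] E} {R X : E →L[ℂ] E}
    (h : IsWeaklyCommutingPair A S.graph T.graph R X) (hd : Dense {x | ∃ y, (x, y) ∈ T.graph})
    {ν : ℝ} (hν : |ν| = 1) :
    Dense {f | ∃ p ∈ (sumOperator A S T).graph, p.2 - (Complex.I * ν) • p.1 = f} := by
  refine dense_closure.1 ((dense_prod (A := A) hd).mono ?_)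
  rintro z ⟨⟨f', hf⟩, ⟨g', hg⟩⟩
  refine Metric.mem_closure_iff.2 fun ε hε => ?_
  obtain ⟨p, hp, q, hq, a, b, ha, hb, h1, h2⟩ :=
    h.exists_approximate_solution hν hf hg (δ := ε / 4) (by positivity)
  refine ⟨_, ⟨((WithCStarModule.equiv A (E × E)).symm (p.1, q.1),
    (WithCStarModule.equiv A (E × E)).symm (q.2 - Complex.I • b, p.2 + Complex.I • a)),
    mem_sumOperator_graph.2 ⟨p.2, a, q.2, b, hp, ha, hq, hb, rfl, rfl⟩, rfl⟩, ?_⟩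
  rw [dist_comm, dist_eq_norm]
  refine (WithCStarModule.prod_norm_le_norm_add _).trans_lt ?_
  have h3 := add_le_add h1 h2
  exact h3.trans_lt (by linarith)

end SumOperator

end HilbertModule

theorem theorem7 {A E : Type*} [NonUnitalCStarAlgebra A] [PartialOrder A] [StarOrderedRing A]
    [NormedAddCommGroup E] [NormedSpace ℂ E] [SMul A E] [CStarModule A E] [CompleteSpace E]
    (S T : E →ₗ.[ℂ] E)
    (hS : HilbertModule.IsSelfadjoint A S) (hS' : HilbertModule.IsRegular A S)
    (hT : HilbertModule.IsSelfadjoint A T) (hT' : HilbertModule.IsRegular A T)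
    (hST : ∃ M : Submodule ℂ E, HilbertModule.CommutatorCondition A S T M) :
    HilbertModule.IsSelfadjoint A (HilbertModule.sumOperator A S T) ∧
      HilbertModule.IsRegular A (HilbertModule.sumOperator A S T) := by
  obtain ⟨M, hM⟩ := hST
  obtain ⟨R, -, hR, hR'⟩ := HilbertModule.exists_resolvent hS hS' one_ne_zero
  simp only [Complex.ofReal_one, mul_one] at hR hR'
  obtain ⟨X, hX⟩ := hM.exists_resolvent_comm hS hT'.isClosed hR'
  have h : HilbertModule.IsWeaklyCommutingPair A S.graph T.graph R X :=
    { symm_left := hS.inner_eq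
      symm_right := hT.inner_eq
      resolvent_mem := hR
      resolvent_apply := hR'
      surjective := fun μ hμ f => HilbertModule.surjective_sub_I_smul hS hS'
        (by rintro rfl; simp at hμ) f
      exists_isSmoothing := fun m hm => HilbertModule.exists_isSmoothing hT hT' hm
      resolvent_comm := hX }
  have hd : Dense {x | ∃ y, (x, y) ∈ T.graph} :=
    hT.isSemiregular.dense_domain.mono fun x hx => ⟨_, T.mem_graph ⟨x, hx⟩⟩
  refine HilbertModule.isSelfadjoint_and_isRegular_of_dense_range ?_ ?_
    (HilbertModule.inner_sumOperator_eq hS.inner_eq hT.inner_eq)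
    (HilbertModule.isClosed_sumOperator h hd hS'.isClosed hT'.isClosed)
    (fun ν hν => HilbertModule.dense_range_sumOperator_sub h hd hν)
  · intro a x hx
    have hS1 := hS.isSemiregular.isSubmodule_domain a
    have hT1 := hT.isSemiregular.isSubmodule_domain a
    exact ⟨⟨hS1 _ hx.1.1, hT1 _ hx.1.2⟩, ⟨hS1 _ hx.2.1, hT1 _ hx.2.2⟩⟩
  · have hdom := HilbertModule.dense_domain_inf h hS.isSemiregular.dense_domain
      hT.isSemiregular.dense_domain
    exact HilbertModule.dense_prod (A := A) hdom
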